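/- Graphs are finite and loopless, but may have multiple edges. A plane graph is a graph drawn in the Euclidean plane: its vertices are points, its edges are arcs joining two distinct vertices and containing no other vertex, and two different edges meet only in vertices. Its faces are the connected components of the complement of the drawing; a vertex is incident with a face if it lies on the boundary of the face, and the degree $\deg_G(f)$ of a face $f$ of $G$ is the number of vertices incident with $f$. A cyclic coloring of $G$ is a coloring of its vertices in which any two different vertices incident with the same face receive different colors, and $\chi_c(G)$ is the minimum number of colors in a cyclic coloring of $G$. A subdivision of a plane graph $R$ is a plane graph obtained from $R$ by a finite sequence of steps, each of which places a new vertex in the interior of an edge and replaces that edge with the two arcs into which the vertex divides it. A subdivision $G$ of $R$ is the same subset of the plane as $R$ and so has the same faces; for a face $f$ of $G$ let $f'$ be the corresponding face of $R$, i.e. the same region regarded as a face of $R$. A graph is $3$-connected if it has at least four vertices and deleting at most two vertices always leaves a connected graph. Theorem. If $G$ is a subdivision of a $3$-connected plane graph $R$, then $$\chi_c(G)\le \Big\lfloor \tfrac32 \max_{f\in F(G)}\{\deg_G(f)-\deg_R(f')\}\Big\rfloor+\chi_c(R),$$ where $F(G)$ is the set of faces of $G$. Moreover, the bound is tight: for every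 integer $a\ge 2$ there are a simple $3$-connected plane graph $R$ and a subdivision $G$ of $R$ with $\max_{f\in F(G)}\{\deg_G(f)-\deg_R(f')\}=2a$ for which equality holds. -/

import Mathlib

open Set

/-- `A` is an arc in the plane (identified with `ℂ`) with end points `u` and `v`: the image of an
injective path from `u` to `v`. In particular `u ≠ v`. -/
def IsArc (u v : ℂ) (A : Set ℂ) : Prop :=
  ∃ γ : Path u v, Function.Injective γ ∧ range γ = A

/-- A finite plane graph. The vertices are points of the plane and the edges are arcs; an edge joins
two (distinct) vertices and contains no other vertex, and two different edges meet only in vertices.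
Several edges may have the same two ends; there are no loops. -/
structure PlaneGraph where
  verts : Set ℂ
  edges : Set (Set ℂ)
  verts_finite : verts.Finite
  edges_finite : edges.Finite
  edge_isArc : ∀ e ∈ edges, ∃ u v : ℂ, IsArc u v e ∧ e ∩ verts = {u, v}
  edge_inter : ∀ e ∈ edges, ∀ e' ∈ edges, e ≠ e' → e ∩ e' ⊆ verts

namespace PlaneGraph

/-- The adjacency relation of a plane graph. -/
def adjGraph (G : PlaneGraph) : SimpleGraph G.verts where
  Adj u v := u ≠ v ∧ ∃ e ∈ G.edges, e ∩ G.verts = {(u : ℂ), (v : ℂ)}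
  symm := ⟨fun u v h => ⟨h.1.symm, by
    obtain ⟨e, he, h'⟩ := h.2
    exact ⟨e, he, by rw [h', pair_comm]⟩⟩⟩
  loopless := ⟨fun _ h => h.1 rfl⟩

/-- No two edges have the same ends. -/
def IsSimple (G : PlaneGraph) : Prop :=
  ∀ e ∈ G.edges, ∀ e' ∈ G.edges, e ∩ G.verts = e' ∩ G.verts → e = e'

/-- At least four vertices, and deleting at most two vertices leaves a connected graph. -/
def IsThreeConnected (G : PlaneGraph) : Prop :=
  4 ≤ G.verts.ncard ∧
    ∀ X : Set G.verts, X.ncard ≤ 2 → (G.adjGraph.induce Xᶜ).Connected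

/-- The set of all points of the plane that lie on the graph. -/
def support (G : PlaneGraph) : Set ℂ :=
  G.verts ∪ ⋃₀ G.edges

/-- The faces: the connected components of the complement of the graph in the plane. -/
def faces (G : PlaneGraph) : Set (Set ℂ) :=
  {f | ∃ x ∈ G.supportᶜ, f = connectedComponentIn G.supportᶜ x}

/-- The set of vertices incident with a face, i.e. lying on its boundary. -/
def faceVerts (G : PlaneGraph) (f : Set ℂ) : Set ℂ :=
  G.verts ∩ frontier f

/-- The degree of a face: the number of vertices incident with it. -/
noncomputable def faceDegree (G : PlaneGraph) (f : Set ℂ) : ℕ :=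
  (G.faceVerts f).ncard

/-- Any two different vertices incident with the same face receive different colors. -/
def IsCyclicColoring (G : PlaneGraph) {C : Type} (c : G.verts → C) : Prop :=
  ∀ f ∈ G.faces, ∀ u v : G.verts, (u : ℂ) ∈ G.faceVerts f → (v : ℂ) ∈ G.faceVerts f →
    u ≠ v → c u ≠ c v

/-- The cyclic chromatic number: the least number of colors in a cyclic coloring. -/
noncomputable def cyclicChromaticNumber (G : PlaneGraph) : ℕ :=
  sInf {k : ℕ | ∃ c : G.verts → Fin k, G.IsCyclicColoring c}

/-- `G` arises from `R` by subdividing one edge `e`, with ends `u` and `v`: a new vertex `w` is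
placed on `e`, and `e` is replaced with its two parts `e₁` from `u` to `w` and `e₂` from `w` to
`v`. -/
def SubdivisionStep (R G : PlaneGraph) : Prop :=
  ∃ e ∈ R.edges, ∃ (u v w : ℂ) (e₁ e₂ : Set ℂ),
    e ∩ R.verts = {u, v} ∧ w ∈ e ∧ w ∉ R.verts ∧
    IsArc u w e₁ ∧ IsArc w v e₂ ∧ e₁ ∪ e₂ = e ∧ e₁ ∩ e₂ = {w} ∧
    G.verts = insert w R.verts ∧ G.edges = (R.edges \ {e}) ∪ {e₁, e₂}

/-- `G` is a subdivision of `R`: it arises from `R` by a finite sequence of subdivisions of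
edges. -/
def IsSubdivision (G R : PlaneGraph) : Prop :=
  Relation.ReflTransGen SubdivisionStep R G

theorem SubdivisionStep.support_eq {R G : PlaneGraph} (h : SubdivisionStep R G) :
    G.support = R.support := by
  obtain ⟨e, he, u, v, w, e₁, e₂, -, hw, -, -, -, hu, -, hV, hE⟩ := h
  have hRE : ⋃₀ R.edges = ⋃₀ (R.edges \ {e}) ∪ e := by
    conv_lhs => rw [← sdiff_union_of_subset (singleton_subset_iff.2 he)]
    rw [sUnion_union, sUnion_singleton]
  have hGE : ⋃₀ G.edges = ⋃₀ R.edges := by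
    rw [hE, sUnion_union, sUnion_pair, hu, hRE]
  rw [support, support, hGE, hV, insert_union, insert_eq_of_mem]
  exact Or.inr ⟨e, he, hw⟩

/-- A subdivision has the same point set, hence the same faces: the face of `R` that corresponds to
a face `f` of `G` is the same region `f` of the plane. -/
theorem IsSubdivision.faces_eq {G R : PlaneGraph} (h : G.IsSubdivision R) :
    G.faces = R.faces := by
  have hs : G.support = R.support := by
    induction h with
    | refl => rfl
    | tail _ hstep ih => rw [hstep.support_eq, ih]
  rw [faces, faces, hs]

/-- The set of all differences `deg_G(f) - deg_R(f')`, where `f` is a face of `G` and `f'` is the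
corresponding face of the graph `R` of which `G` is a subdivision; as regions of the plane,
`f' = f`. -/
def degreeDifferences (G R : PlaneGraph) : Set ℤ :=
  {d | ∃ f ∈ G.faces, d = (G.faceDegree f : ℤ) - (R.faceDegree f : ℤ)}

end PlaneGraph

/-- `f` has a continuous logarithm on `K`. -/
def HasLogOn (f : ℂ → ℂ) (K : Set ℂ) : Prop :=
  ∃ g : ℂ → ℂ, ContinuousOn g K ∧ ∀ z ∈ K, f z = Complex.exp (g z)

namespace HasLogOn

variable {f g : ℂ → ℂ} {K : Set ℂ}

theorem mul (hf : HasLogOn f K) (hg : HasLogOn g K) : HasLogOn (fun z => f z * g z) K := by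
  obtain ⟨u, hu, hfu⟩ := hf
  obtain ⟨v, hv, hgv⟩ := hg
  exact ⟨fun z => u z + v z, hu.add hv, fun z hz => by
    simp only [hfu z hz, hgv z hz, Complex.exp_add]⟩

theorem inv (hf : HasLogOn f K) : HasLogOn (fun z => (f z)⁻¹) K := by
  obtain ⟨u, hu, hfu⟩ := hf
  exact ⟨fun z => - u z, hu.neg, fun z hz => by simp only [hfu z hz, Complex.exp_neg]⟩

theorem congr (hf : HasLogOn f K) (h : ∀ z ∈ K, f z = g z) : HasLogOn g K := by
  obtain ⟨u, hu, hfu⟩ := hf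
  exact ⟨u, hu, fun z hz => by rw [← h z hz, hfu z hz]⟩

end HasLogOn

/-- Two logarithms on closed sets that differ by a constant on the intersection can be glued. -/
theorem hasLogOn_union {f u v : ℂ → ℂ} {A B : Set ℂ} (hA : IsClosed A) (hB : IsClosed B)
    (hu : ContinuousOn u A) (hv : ContinuousOn v B) (hfu : ∀ z ∈ A, f z = Complex.exp (u z))
    (hfv : ∀ z ∈ B, f z = Complex.exp (v z)) (n : ℤ)
    (h : ∀ z ∈ A ∩ B, u z - v z = n * (2 * Real.pi * Complex.I)) : HasLogOn f (A ∪ B) := by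
  classical
  let w : ℂ → ℂ := fun z => if z ∈ A then u z else v z + n * (2 * Real.pi * Complex.I)
  have hwA : EqOn w u A := fun z hz => if_pos hz
  have hwB : EqOn w (fun z => v z + n * (2 * Real.pi * Complex.I)) B := by
    intro z hz
    by_cases hzA : z ∈ A
    · simp only [w, if_pos hzA]
      linear_combination h z ⟨hzA, hz⟩
    · simp only [w, if_neg hzA]
  refine ⟨w, ContinuousOn.union_of_isClosed (hu.congr hwA)
    ((hv.add continuousOn_const).congr hwB) hA hB, ?_⟩
  rintro z (hz | hz)
  · rw [hwA hz, hfu z hz]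
  · rw [hwB hz, hfv z hz, Complex.exp_add, Complex.exp_int_mul_two_pi_mul_I, mul_one]

open Topology Filter in
theorem hasLogOn_div_of_mem_preconnected {K S : Set ℂ} (hK : IsClosed K) (hS : IsPreconnected S)
    (hSK : S ⊆ Kᶜ) {a b : ℂ} (ha : a ∈ S) (hb : b ∈ S) :
    HasLogOn (fun z => (z - a) / (z - b)) K := by
  have hne : ∀ x ∈ S, ∀ z ∈ K, z - x ≠ 0 := fun x hx z hz h =>
    hSK hx (by rwa [← sub_eq_zero.1 h])
  refine hS.induction₂ (fun a b => HasLogOn (fun z => (z - a) / (z - b)) K) ?_ ?_ ?_ ha hb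
  · intro x hx
    obtain ⟨ε, hε, hball⟩ := Metric.isOpen_iff.1 hK.isOpen_compl x (hSK hx)
    have : ∀ᶠ y in 𝓝[S] x, y ∈ S ∧ dist y x < ε / 2 :=
      (eventually_mem_nhdsWithin).and (nhdsWithin_le_nhds (Metric.ball_mem_nhds x (half_pos hε)))
    filter_upwards [this] with y ⟨hyS, hy⟩
    have hlt : ∀ z ∈ K, ‖(y - x) / (z - y)‖ < 1 := by
      intro z hz
      have h1 : ε ≤ dist z x := by
        by_contra! h
        exact hball h hz
      have h2 : dist z x ≤ dist z y + dist y x := dist_triangle _ _ _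
      rw [norm_div, div_lt_one (norm_pos_iff.2 (hne y hyS z hz)), ← dist_eq_norm, ← dist_eq_norm]
      linarith
    have heq : ∀ z ∈ K, (z - x) / (z - y) = 1 + (y - x) / (z - y) := by
      intro z hz
      have := hne y hyS z hz
      field_simp
      ring
    have hslit : ∀ z ∈ K, (z - x) / (z - y) ∈ Complex.slitPlane := fun z hz => by
      rw [heq z hz]
      exact Complex.mem_slitPlane_of_norm_lt_one (hlt z hz)
    refine ⟨fun z => Complex.log ((z - x) / (z - y)), ContinuousOn.clog ?_ hslit, fun z hz => ?_⟩
    · exact ContinuousOn.div (by fun_prop) (by fun_prop) (hne y hyS)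
    · rw [Complex.exp_log (Complex.slitPlane_ne_zero (hslit z hz))]
  · intro x y w hx hy hw h1 h2
    refine (h1.mul h2).congr fun z hz => ?_
    have := hne y hy z hz
    have := hne w hw z hz
    field_simp
  · intro x y hx hy h
    exact h.inv.congr fun z _ => by rw [inv_div]

theorem IsArc.isCompact {u v : ℂ} {e : Set ℂ} (h : IsArc u v e) : IsCompact e := by
  obtain ⟨γ, -, rfl⟩ := h
  exact isCompact_range γ.continuous

theorem IsArc.hasLogOn {u v : ℂ} {e : Set ℂ} (h : IsArc u v e) {f : ℂ → ℂ}
    (hf : ContinuousOn f e) (h0 : ∀ z ∈ e, f z ≠ 0) : HasLogOn f e := by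
  obtain ⟨γ, hγ, rfl⟩ := h
  have hfγ : Continuous fun t => f (γ t) :=
    hf.comp_continuous γ.continuous fun t => mem_range_self t
  obtain ⟨F, ⟨-, hF⟩, -⟩ := Complex.isCoveringMapOn_exp.existsUnique_continuousMap_lifts
    (⟨fun t : ℝ => f (γ (projIcc 0 1 zero_le_one t)), hfγ.comp continuous_projIcc⟩ : C(ℝ, ℂ))
    (a₀ := 0) (Complex.exp_log (h0 _ (mem_range_self _))) (fun t => h0 _ (mem_range_self _))
  have hemb : Topology.IsClosedEmbedding γ := γ.continuous.isClosedEmbedding hγ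
  refine ⟨Function.extend γ (fun t => F t) 0, ?_, ?_⟩
  · rw [continuousOn_iff_continuous_domRestrict]
    have : (range γ).domRestrict (Function.extend γ (fun t => F t) 0) =
        (fun t : unitInterval => F t) ∘ hemb.isEmbedding.toHomeomorph.symm := by
      funext z
      obtain ⟨t, rfl⟩ := hemb.isEmbedding.toHomeomorph.surjective z
      simp [Set.domRestrict, hγ.extend_apply]
    rw [this]
    exact (F.continuous.comp continuous_subtype_val).comp (Homeomorph.continuous _)
  · rintro _ ⟨t, rfl⟩
    rw [hγ.extend_apply]
    simpa using (congrFun hF t).symm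

/-- A nonzero power of `z - a` has no continuous logarithm on the plane's circles around `a`. -/
theorem not_hasLogOn_sphere (a : ℂ) {r : ℝ} (hr : 0 < r) {k : ℤ} (hk : k ≠ 0) :
    ¬ HasLogOn (fun z => (z - a) ^ k) (Metric.sphere a r) := by
  rintro ⟨g, hg, hgz⟩
  have hmem : ∀ θ : ℝ, circleMap a r θ ∈ Metric.sphere a r := circleMap_mem_sphere a hr.le
  let h : ℝ → ℂ := fun θ => (g (circleMap a r θ) - k * (θ * Complex.I) - k * Real.log r) /
    (2 * Real.pi * Complex.I)
  have hc : Continuous h := by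
    have : Continuous fun θ => g (circleMap a r θ) :=
      hg.comp_continuous (continuous_circleMap a r) hmem
    exact ((this.sub (by fun_prop)).sub continuous_const).div_const _
  have hint : ∀ θ, ∃ n : ℤ, h θ = n := by
    intro θ
    have h1 : (circleMap a r θ - a) ^ k = _ := hgz _ (hmem θ)
    have h2 : circleMap a r θ - a = Complex.exp (Real.log r + θ * Complex.I) := by
      rw [Complex.exp_add, ← Complex.ofReal_exp, Real.exp_log hr]
      simp [circleMap]
    rw [h2, ← Complex.exp_int_mul] at h1
    obtain ⟨n, hn⟩ := Complex.exp_eq_exp_iff_exists_int.1 h1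
    refine ⟨-n, ?_⟩
    have hpi : (2 * Real.pi * Complex.I : ℂ) ≠ 0 := Complex.two_pi_I_ne_zero
    simp only [h]
    rw [div_eq_iff hpi]
    push_cast
    linear_combination -hn
  choose N hN using hint
  have hNc : Continuous N := by
    have : Continuous fun θ => ((N θ : ℤ) : ℂ) := by simpa only [← hN] using hc
    refine Int.isClosedEmbedding_coe_real.isEmbedding.continuous_iff.2 ?_
    simpa [Function.comp_def] using Complex.continuous_re.comp this
  have hconst : h 0 = h (2 * Real.pi) := by
    rw [hN, hN, PreconnectedSpace.constant inferInstance hNc]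
  have hpi : (2 * Real.pi * Complex.I : ℂ) ≠ 0 := Complex.two_pi_I_ne_zero
  have hper : circleMap a r (2 * Real.pi) = circleMap a r 0 := by
    simpa using periodic_circleMap a r 0
  simp only [h] at hconst
  rw [hper, div_left_inj' hpi] at hconst
  have : (k : ℂ) * (2 * Real.pi * Complex.I) = 0 := by
    push_cast at hconst
    linear_combination hconst
  rcases mul_eq_zero.1 this with h' | h'
  · exact hk (by exact_mod_cast h')
  · exact hpi h'

/-- If `U` is a bounded open set with boundary in the closed set `K`, and `a ∈ U`, then no nonzero
power of `z - a`, even multiplied with a nonvanishing function on the closure of `U`, has a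
continuous logarithm on `K`. -/
theorem not_hasLogOn_of_bounded {K U : Set ℂ} (hK : IsClosed K) (hU : IsOpen U)
    (hUb : Bornology.IsBounded U) (hfr : frontier U ⊆ K) {a : ℂ} (ha : a ∈ U) {k : ℤ}
    (hk : k ≠ 0) {h : ℂ → ℂ} (hh : ContinuousOn h (closure U)) (h0 : ∀ z ∈ closure U, h z ≠ 0) :
    ¬ HasLogOn (fun z => (z - a) ^ k * h z) K := by
  classical
  rintro ⟨g, hg, hgz⟩
  obtain ⟨G, hG⟩ := ContinuousMap.exists_restrict_eq hK
    (⟨K.domRestrict g, continuousOn_iff_continuous_domRestrict.1 hg⟩ : C(K, ℂ))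
  have hGg : ∀ z ∈ K, G z = g z := fun z hz => congrArg (fun F : C(K, ℂ) => F ⟨z, hz⟩) hG
  let q : ℂ → ℂ := fun z => if z ∈ closure U then Complex.exp (G z) / h z else (z - a) ^ k
  have hq1 : EqOn q (fun z => Complex.exp (G z) / h z) (closure U) := fun z hz => if_pos hz
  have hq2 : EqOn q (fun z => (z - a) ^ k) Uᶜ := by
    intro z hz
    by_cases hz' : z ∈ closure U
    · have hzK : z ∈ K := hfr ⟨hz', by rwa [hU.interior_eq]⟩
      rw [hq1 hz']
      simp only
      rw [hGg z hzK, ← hgz z hzK, mul_div_cancel_right₀ _ (h0 z hz')]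
    · exact if_neg hz'
  have hne : ∀ z ∈ Uᶜ, z - a ≠ 0 := fun z hz h => hz (by rwa [sub_eq_zero.1 h])
  have hqc : Continuous q := by
    rw [← continuousOn_univ, ← union_compl_self U]
    refine ContinuousOn.mono (s := closure U ∪ Uᶜ) ?_ (union_subset_union_left _ subset_closure)
    refine ContinuousOn.union_of_isClosed (ContinuousOn.congr ?_ hq1) (ContinuousOn.congr ?_ hq2)
      isClosed_closure hU.isClosed_compl
    · exact ContinuousOn.div (by fun_prop) hh h0
    · exact ContinuousOn.zpow₀ (by fun_prop) k fun z hz => Or.inl (hne z hz)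
  have hq0 : ∀ z, q z ≠ 0 := by
    intro z
    by_cases hz : z ∈ closure U
    · rw [hq1 hz]
      exact div_ne_zero (Complex.exp_ne_zero _) (h0 z hz)
    · have hz' : z ∈ Uᶜ := fun h => hz (subset_closure h)
      rw [hq2 hz']
      exact zpow_ne_zero _ (hne z hz')
  obtain ⟨F, ⟨-, hF⟩, -⟩ := Complex.isCoveringMapOn_exp.existsUnique_continuousMap_lifts
    (⟨q, hqc⟩ : C(ℂ, ℂ)) (a₀ := 0) (Complex.exp_log (hq0 0)) (fun t => hq0 t)
  obtain ⟨r, hr⟩ := hUb.subset_ball a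
  have hr0 : 0 < r := by
    have := hr ha
    simpa using this
  refine not_hasLogOn_sphere a hr0 hk ⟨F, F.continuous.continuousOn, fun z hz => ?_⟩
  have hzU : z ∈ Uᶜ := fun h => by
    have := hr h
    rw [Metric.mem_ball, Metric.mem_sphere.1 hz] at this
    exact lt_irrefl _ this
  rw [← hq2 hzU]
  exact (congrFun hF z).symm

theorem isPreconnected_norm_sub_mem (c : ℂ) {J : Set ℝ} (hJ : IsPreconnected J)
    (hJ0 : ∀ r ∈ J, 0 ≤ r) : IsPreconnected {z : ℂ | ‖z - c‖ ∈ J} := by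
  have : {z : ℂ | ‖z - c‖ ∈ J} =
      (fun p : ℝ × ℝ => c + (p.1 : ℂ) * Complex.exp (p.2 * Complex.I)) '' (J ×ˢ univ) := by
    ext z
    constructor
    · intro hz
      exact ⟨(‖z - c‖, (z - c).arg), ⟨hz, trivial⟩, by
        simp only [Complex.norm_mul_exp_arg_mul_I, add_sub_cancel]⟩
    · rintro ⟨p, ⟨hp, -⟩, rfl⟩
      simpa [Complex.norm_exp_ofReal_mul_I, abs_of_nonneg (hJ0 _ hp)] using hp
  rw [this]
  exact (hJ.prod isPreconnected_univ).image _ (by fun_prop)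

/-- The complement of a compact set has at most one unbounded component. -/
theorem connectedComponentIn_eq_of_not_isBounded {K : Set ℂ} (hK : IsCompact K) {a b : ℂ}
    (ha : ¬ Bornology.IsBounded (connectedComponentIn Kᶜ a))
    (hb : ¬ Bornology.IsBounded (connectedComponentIn Kᶜ b)) :
    connectedComponentIn Kᶜ a = connectedComponentIn Kᶜ b := by
  obtain ⟨r, hr, hKr⟩ := hK.isBounded.exists_pos_norm_le
  have hconn : IsPreconnected {z : ℂ | r < ‖z‖} := by
    simpa using isPreconnected_norm_sub_mem 0 (isPreconnected_Ioi (a := r))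
      fun t ht => hr.le.trans (le_of_lt ht)
  have hsub : {z : ℂ | r < ‖z‖} ⊆ Kᶜ := fun z hz h => (hKr z h).not_gt hz
  have key : ∀ c, ¬ Bornology.IsBounded (connectedComponentIn Kᶜ c) →
      ∃ z, r < ‖z‖ ∧ z ∈ connectedComponentIn Kᶜ c := by
    intro c hc
    by_contra! h
    exact hc (isBounded_iff_forall_norm_le.2 ⟨r, fun z hz => not_lt.1 fun h' => h z h' hz⟩)
  obtain ⟨x, hx, hxa⟩ := key a ha
  obtain ⟨y, hy, hyb⟩ := key b hb
  rw [connectedComponentIn_eq hxa, connectedComponentIn_eq hyb]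
  exact connectedComponentIn_eq (hconn.subset_connectedComponentIn hx hsub hy)

theorem frontier_connectedComponentIn_compl_subset {K : Set ℂ} (hK : IsClosed K) (a : ℂ) :
    frontier (connectedComponentIn Kᶜ a) ⊆ K := by
  intro z hz
  by_contra hzK
  have hopen : IsOpen (connectedComponentIn Kᶜ z) := hK.isOpen_compl.connectedComponentIn
  have hzm : z ∈ connectedComponentIn Kᶜ z := mem_connectedComponentIn hzK
  obtain ⟨y, hy1, hy2⟩ := mem_closure_iff.1 hz.1 _ hopen hzm
  have : z ∈ connectedComponentIn Kᶜ a := by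
    rw [connectedComponentIn_eq hy2, ← connectedComponentIn_eq hy1]
    exact hzm
  exact hz.2 (by rwa [hK.isOpen_compl.connectedComponentIn.interior_eq])

/-- Adding an arc whose interior misses the compact set `K` splits each component of the complement
of `K` into at most two parts. -/
theorem connectedComponentIn_union_arc {K e S : Set ℂ} {u v : ℂ} (hK : IsCompact K)
    (he : IsArc u v e) (hKe : K ∩ e ⊆ {u, v}) (hS : IsPreconnected S) (hSK : S ⊆ Kᶜ) (a : Fin 3 → ℂ)
    (haS : ∀ i, a i ∈ S) (hae : ∀ i, a i ∉ e) :
    ¬ Function.Injective fun i => connectedComponentIn (K ∪ e)ᶜ (a i) := by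
  intro hinj
  have hec : IsClosed e := he.isCompact.isClosed
  have hmem : ∀ i, a i ∈ (K ∪ e)ᶜ := fun i h => h.elim (hSK (haS i)) (hae i)
  have hlog : ∀ i j, ∃ u₁ u₂ : ℂ → ℂ, ContinuousOn u₁ K ∧ ContinuousOn u₂ e ∧
      (∀ z ∈ K, (z - a i) / (z - a j) = Complex.exp (u₁ z)) ∧
      (∀ z ∈ e, (z - a i) / (z - a j) = Complex.exp (u₂ z)) := by
    intro i j
    obtain ⟨u₁, h₁, h₁'⟩ := hasLogOn_div_of_mem_preconnected hK.isClosed hS hSK (haS i) (haS j)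
    have hne : ∀ i, ∀ z ∈ e, z - a i ≠ 0 := fun i z hz h => hae i (by rwa [← sub_eq_zero.1 h])
    obtain ⟨u₂, h₂, h₂'⟩ := he.hasLogOn (f := fun z => (z - a i) / (z - a j))
      (ContinuousOn.div (by fun_prop) (by fun_prop) (hne j))
      (fun z hz => div_ne_zero (hne i z hz) (hne j z hz))
    exact ⟨u₁, u₂, h₁, h₂, h₁', h₂'⟩
  obtain ⟨f₁, f₂, hf₁, hf₂, hf₁', hf₂'⟩ := hlog 0 1
  obtain ⟨g₁, g₂, hg₁, hg₂, hg₁', hg₂'⟩ := hlog 1 2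
  have hdiff : ∀ (φ f₁ f₂ : ℂ → ℂ), (∀ z ∈ K, φ z = Complex.exp (f₁ z)) →
      (∀ z ∈ e, φ z = Complex.exp (f₂ z)) →
      ∃ d : ℂ → ℤ, ∀ z ∈ K ∩ e, f₁ z - f₂ z = d z * (2 * Real.pi * Complex.I) := by
    intro φ f₁ f₂ h1 h2
    have : ∀ z, ∃ n : ℤ, z ∈ K ∩ e → f₁ z - f₂ z = n * (2 * Real.pi * Complex.I) := by
      intro z
      by_cases hz : z ∈ K ∩ e
      · obtain ⟨n, hn⟩ := Complex.exp_eq_exp_iff_exists_int.1 ((h1 z hz.1).symm.trans (h2 z hz.2))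
        exact ⟨n, fun _ => by linear_combination hn⟩
      · exact ⟨0, fun h => absurd h hz⟩
    choose d hd using this
    exact ⟨d, hd⟩
  obtain ⟨d, hd⟩ := hdiff _ f₁ f₂ hf₁' hf₂'
  obtain ⟨d', hd'⟩ := hdiff _ g₁ g₂ hg₁' hg₂'
  obtain ⟨p, q, hpq, hrel⟩ : ∃ p q : ℤ, (p ≠ 0 ∨ q ≠ 0) ∧
      p * d u + q * d' u = p * d v + q * d' v := by
    by_cases h : d u = d v
    · exact ⟨1, 0, Or.inl one_ne_zero, by simp [h]⟩
    · exact ⟨d' v - d' u, d u - d v, Or.inr (sub_ne_zero.2 h), by ring⟩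
  have hL : HasLogOn (fun z => ((z - a 0) / (z - a 1)) ^ p * ((z - a 1) / (z - a 2)) ^ q)
      (K ∪ e) := by
    refine hasLogOn_union (u := fun z => p * f₁ z + q * g₁ z) (v := fun z => p * f₂ z + q * g₂ z)
      hK.isClosed hec (by fun_prop) (by fun_prop) ?_ ?_ (p * d u + q * d' u) ?_
    · intro z hz
      rw [hf₁' z hz, hg₁' z hz, Complex.exp_add, Complex.exp_int_mul, Complex.exp_int_mul]
    · intro z hz
      rw [hf₂' z hz, hg₂' z hz, Complex.exp_add, Complex.exp_int_mul, Complex.exp_int_mul]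
    · intro z hz
      have h1 := hd z hz
      have h2 := hd' z hz
      have h3 : p * d z + q * d' z = p * d u + q * d' u := by
        rcases hKe hz with h | h
        · rw [h]
        · rw [show z = v from h, hrel]
      have h4 : ((p : ℂ) * d z + q * d' z) = ((p * d u + q * d' u : ℤ) : ℂ) := by
        rw [← h3]
        push_cast
        ring
      rw [← h4]
      linear_combination (p : ℂ) * h1 + (q : ℂ) * h2
  have hclosed : IsClosed (K ∪ e) := hK.isClosed.union hec
  -- every component with a nonzero exponent is unbounded
  have hub : ∀ (i : Fin 3) (n : Fin 3 → ℤ), n i ≠ 0 →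
      HasLogOn (fun z => (z - a 0) ^ n 0 * (z - a 1) ^ n 1 * (z - a 2) ^ n 2) (K ∪ e) →
      ¬ Bornology.IsBounded (connectedComponentIn (K ∪ e)ᶜ (a i)) := by
    intro i n hn h hb
    have hfr := frontier_connectedComponentIn_compl_subset hclosed (a i)
    have hne : ∀ j, j ≠ i → ∀ z ∈ closure (connectedComponentIn (K ∪ e)ᶜ (a i)),
        z - a j ≠ 0 := by
      intro j hj z hz h0
      rw [sub_eq_zero.1 h0] at hz
      by_cases hin : a j ∈ connectedComponentIn (K ∪ e)ᶜ (a i)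
      · exact hj (hinj (connectedComponentIn_eq hin).symm)
      · exact hmem j (hfr ⟨hz, fun h => hin (interior_subset h)⟩)
    refine not_hasLogOn_of_bounded hclosed hclosed.isOpen_compl.connectedComponentIn hb hfr
      (mem_connectedComponentIn (hmem i)) hn
      (h := fun z => ∏ j ∈ Finset.univ.erase i, (z - a j) ^ n j) ?_ ?_ (h.congr fun z _ => ?_)
    · refine continuousOn_finsetProd _ fun j hj => ?_
      exact ContinuousOn.zpow₀ (by fun_prop) _ fun z hz =>
        Or.inl (hne j (Finset.ne_of_mem_erase hj) z hz)
    · intro z hz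
      exact Finset.prod_ne_zero_iff.2 fun j hj =>
        zpow_ne_zero _ (hne j (Finset.ne_of_mem_erase hj) z hz)
    · rw [Finset.mul_prod_erase Finset.univ (fun j => (z - a j) ^ n j) (Finset.mem_univ i),
        Fin.prod_univ_three]
  have hL' : HasLogOn (fun z => (z - a 0) ^ (![p, q - p, -q] 0) * (z - a 1) ^ (![p, q - p, -q] 1) *
      (z - a 2) ^ (![p, q - p, -q] 2)) (K ∪ e) := by
    refine hL.congr fun z hz => ?_
    have h1 : z - a 1 ≠ 0 := fun h => hmem 1 (by rwa [← sub_eq_zero.1 h])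
    simp only [Matrix.cons_val_zero, Matrix.cons_val_one, Matrix.cons_val]
    rw [div_zpow, div_zpow, zpow_sub₀ h1, zpow_neg]
    ring
  have two : ∀ i j : Fin 3, i ≠ j → (![p, q - p, -q] i) ≠ 0 → (![p, q - p, -q] j) ≠ 0 → False :=
    fun i j hij hi hj => hij (hinj (connectedComponentIn_eq_of_not_isBounded
      (hK.union he.isCompact) (hub i _ hi hL') (hub j _ hj hL')))
  by_cases hp : p = 0
  · have hq : q ≠ 0 := hpq.resolve_left (not_not.2 hp)
    exact two 1 2 (by decide) (by simpa [hp] using hq) (by simpa using hq)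
  · by_cases hq : q = 0
    · exact two 0 1 (by decide) (by simpa using hp) (by simpa [hq] using hp)
    · exact two 0 2 (by decide) (by simpa using hp) (by simpa using hq)

section EdgeColoring

variable {E V C : Type*}

/-- The elements of `s` that are incident with the same vertex receive different colors. -/
def IsProperOn (I : E → V → Prop) (s : Set E) (c : E → C) : Prop :=
  ∀ v, ∀ e ∈ s, ∀ e' ∈ s, I e v → I e' v → c e = c e' → e = e'

/-- The color `γ` is not used on the edges of `s` at `v`. -/
def IsMissing (I : E → V → Prop) (s : Set E) (c : E → C) (v : V) (γ : C) : Prop :=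
  ∀ e ∈ s, I e v → c e ≠ γ

variable {I : E → V → Prop} {s : Set E} {c : E → C}

theorem IsProperOn.mono {t : Set E} (h : IsProperOn I s c) (hts : t ⊆ s) : IsProperOn I t c :=
  fun v e he e' he' => h v e (hts he) e' (hts he')

theorem IsProperOn.update_insert [DecidableEq E] (h : IsProperOn I s c) {e₀ : E} (he₀ : e₀ ∉ s)
    {γ : C} (hγ : ∀ v, I e₀ v → IsMissing I s c v γ) :
    IsProperOn I (insert e₀ s) (Function.update c e₀ γ) := by
  have hne : ∀ e ∈ s, e ≠ e₀ := fun e he h => he₀ (h ▸ he)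
  rintro v e (rfl | he) e' (rfl | he') hv hv' hc
  · rfl
  · rw [Function.update_self, Function.update_of_ne (hne e' he')] at hc
    exact absurd hc.symm (hγ v hv e' he' hv')
  · rw [Function.update_self, Function.update_of_ne (hne e he)] at hc
    exact absurd hc (hγ v hv' e he hv)
  · rw [Function.update_of_ne (hne e he), Function.update_of_ne (hne e' he')] at hc
    exact h v e he e' he' hv hv' hc

open Classical in
/-- Interchange of the colors `α` and `β` on all edges that meet the vertex set `T`. -/
noncomputable def kempeSwap (I : E → V → Prop) (α β : C) (T : Set V) (c : E → C) : E → C :=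
  fun e => if ∃ v ∈ T, I e v then Equiv.swap α β (c e) else c e

section Kempe

variable {α β : C} {T : Set V}

/-- No edge of `s` that is colored `α` or `β` leaves `T`. -/
def IsKempeClosed (I : E → V → Prop) (s : Set E) (c : E → C) (α β : C) (T : Set V) : Prop :=
  ∀ e ∈ s, c e = α ∨ c e = β → ∀ v ∈ T, I e v → ∀ w, I e w → w ∈ T

open Classical in
theorem kempeSwap_of_mem {e : E} {v : V} (hv : v ∈ T) (hev : I e v) :
    kempeSwap I α β T c e = Equiv.swap α β (c e) :=
  if_pos ⟨v, hv, hev⟩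

theorem IsKempeClosed.kempeSwap_of_notMem (hT : IsKempeClosed I s c α β T) {e : E} (he : e ∈ s)
    {v : V} (hv : v ∉ T) (hev : I e v) : kempeSwap I α β T c e = c e := by
  classical
  by_cases h : ∃ w ∈ T, I e w
  · obtain ⟨w, hw, hew⟩ := h
    have hne : ¬ (c e = α ∨ c e = β) := fun h => hv (hT e he h w hw hew v hev)
    rw [kempeSwap_of_mem hw hew]
    exact Equiv.swap_apply_of_ne_of_ne (fun h => hne (Or.inl h)) (fun h => hne (Or.inr h))
  · exact if_neg h

theorem IsKempeClosed.isProperOn (hT : IsKempeClosed I s c α β T) (hc : IsProperOn I s c) :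
    IsProperOn I s (kempeSwap I α β T c) := by
  classical
  intro v e he e' he' hv hv' h
  by_cases hvT : v ∈ T
  · rw [kempeSwap_of_mem hvT hv, kempeSwap_of_mem hvT hv'] at h
    exact hc v e he e' he' hv hv' ((Equiv.swap α β).injective h)
  · rw [hT.kempeSwap_of_notMem he hvT hv, hT.kempeSwap_of_notMem he' hvT hv'] at h
    exact hc v e he e' he' hv hv' h

open Classical in
theorem IsMissing.kempeSwap_of_mem {v : V} {γ : C} (h : IsMissing I s c v γ) (hv : v ∈ T) :
    IsMissing I s (kempeSwap I α β T c) v (Equiv.swap α β γ) := by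
  intro e he hev h'
  rw [_root_.kempeSwap_of_mem hv hev] at h'
  exact h e he hev ((Equiv.swap α β).injective h')

theorem IsMissing.kempeSwap_of_notMem {v : V} {γ : C} (h : IsMissing I s c v γ)
    (hT : IsKempeClosed I s c α β T) (hv : v ∉ T) : IsMissing I s (kempeSwap I α β T c) v γ := by
  intro e he hev h'
  rw [hT.kempeSwap_of_notMem he hv hev] at h'
  exact h e he hev h'

/-- Two vertices are adjacent if they are joined by an edge colored `α` or `β`. -/
def kempeGraph (I : E → V → Prop) (s : Set E) (c : E → C) (α β : C) : SimpleGraph V where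
  Adj u v := u ≠ v ∧ ∃ e ∈ s, (c e = α ∨ c e = β) ∧ I e u ∧ I e v
  symm := ⟨fun _ _ h => ⟨h.1.symm, by
    obtain ⟨e, he, hc, hu, hv⟩ := h.2
    exact ⟨e, he, hc, hv, hu⟩⟩⟩
  loopless := ⟨fun _ h => h.1 rfl⟩

theorem isKempeClosed_supp (K : (kempeGraph I s c α β).ConnectedComponent) :
    IsKempeClosed I s c α β K.supp := by
  intro e he hc v hv hev w hew
  by_cases h : v = w
  · exact h ▸ hv
  · have hadj : (kempeGraph I s c α β).Adj v w := ⟨h, e, he, hc, hev, hew⟩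
    rw [SimpleGraph.ConnectedComponent.mem_supp_iff] at hv ⊢
    rw [← hv]
    exact (SimpleGraph.ConnectedComponent.sound hadj.reachable).symm

end Kempe

/-- A connected graph with maximum degree at most two has at most two vertices of degree at most
one. -/
theorem SimpleGraph.Connected.not_three_ends [Finite V] {G : SimpleGraph V} (hG : G.Connected)
    (hdeg : ∀ v, (G.neighborSet v).ncard ≤ 2) {x y z : V} (hxy : x ≠ y) (hxz : x ≠ z)
    (hyz : y ≠ z) (hx : (G.neighborSet x).ncard ≤ 1) (hy : (G.neighborSet y).ncard ≤ 1)
    (hz : (G.neighborSet z).ncard ≤ 1) : False := by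
  classical
  have := Fintype.ofFinite V
  have hd : ∀ v, (G.neighborSet v).ncard = G.degree v := fun v => by
    rw [← SimpleGraph.card_neighborSet_eq_degree, ← Nat.card_eq_fintype_card,
      Nat.card_coe_set_eq]
  simp only [hd] at hdeg hx hy hz
  have h1 := hG.card_vert_le_card_edgeSet_add_one
  have h2 := G.sum_degrees_eq_twice_card_edges
  rw [Nat.card_eq_fintype_card, Nat.card_eq_fintype_card, ← SimpleGraph.edgeFinset_card] at h1
  have h3 : ∑ v, (G.degree v + if v ∈ ({x, y, z} : Finset V) then 1 else 0) ≤ ∑ _v : V, 2 := by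
    refine Finset.sum_le_sum fun v _ => ?_
    split_ifs with hv
    · simp only [Finset.mem_insert, Finset.mem_singleton] at hv
      rcases hv with rfl | rfl | rfl <;> omega
    · exact hdeg v
  rw [Finset.sum_add_distrib, Finset.sum_ite_mem, Finset.univ_inter, Finset.sum_const,
    Finset.sum_const, Finset.card_univ, smul_eq_mul, smul_eq_mul,
    Finset.card_eq_three.2 ⟨x, y, z, hxy, hxz, hyz, rfl⟩] at h3
  omega

/-- A Kempe chain has at most two ends. -/
theorem IsProperOn.not_three_ends [Finite V] (hc : IsProperOn I s c)
    (h2 : ∀ e, {v | I e v}.encard ≤ 2) {α β : C}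
    (K : (kempeGraph I s c α β).ConnectedComponent) {x y z : V} (hxy : x ≠ y) (hxz : x ≠ z)
    (hyz : y ≠ z) (hxK : x ∈ K.supp) (hyK : y ∈ K.supp) (hzK : z ∈ K.supp)
    (hx : IsMissing I s c x α ∨ IsMissing I s c x β)
    (hy : IsMissing I s c y α ∨ IsMissing I s c y β)
    (hz : IsMissing I s c z α ∨ IsMissing I s c z β) : False := by
  classical
  have hconn : K.toSimpleGraph.Connected := K.connected_toSimpleGraph
  have key : ∀ (v : K.supp) (D : Finset C), (∀ γ ∈ ({α, β} : Finset C), γ ∉ D →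
      IsMissing I s c v γ) → (K.toSimpleGraph.neighborSet v).ncard ≤ D.card := by
    intro v D hD
    have hex : ∀ u ∈ K.toSimpleGraph.neighborSet v, ∃ e ∈ s, (c e = α ∨ c e = β) ∧ I e v ∧ I e u :=
      fun u hu => (show (kempeGraph I s c α β).Adj v u from hu).2
    rcases isEmpty_or_nonempty E with hE | hE
    · rw [Set.eq_empty_of_forall_notMem fun u hu => hE.elim (hex u hu).choose, Set.ncard_empty]
      exact Nat.zero_le _
    choose! φ hφs hφc hφv hφu using hex
    rw [← Set.ncard_coe_finset D]
    refine Set.ncard_le_ncard_of_injOn (fun u => c (φ u)) ?_ ?_ (Finset.finite_toSet D)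
    · intro u hu
      by_contra hnot
      exact hD (c (φ u)) (by simpa using hφc u hu) hnot (φ u) (hφs u hu) (hφv u hu) rfl
    · intro u hu u' hu' heq
      have hee := hc v _ (hφs u hu) _ (hφs u' hu') (hφv u hu) (hφv u' hu') heq
      by_contra hne
      have hvu : (v : V) ≠ u := (show (kempeGraph I s c α β).Adj v u from hu).1
      have hvu' : (v : V) ≠ u' := (show (kempeGraph I s c α β).Adj v u' from hu').1
      have hsub : ({(v : V), (u : V), (u' : V)} : Set V) ⊆ {w | I (φ u) w} := by
        rintro w (rfl | rfl | rfl)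
        · exact hφv u hu
        · exact hφu u hu
        · exact hee ▸ hφu u' hu'
      have h3 : ({(v : V), (u : V), (u' : V)} : Set V).encard = 3 :=
        Set.encard_eq_three.2 ⟨_, _, _, hvu, hvu', fun h => hne (Subtype.ext h), rfl⟩
      have := (Set.encard_le_encard hsub).trans (h2 (φ u))
      rw [h3] at this
      exact absurd this (by decide)
  have hend : ∀ v : K.supp, IsMissing I s c v α ∨ IsMissing I s c v β →
      (K.toSimpleGraph.neighborSet v).ncard ≤ 1 := by
    rintro v (h | h)
    · refine (key v {β} fun γ hγ hγ' => ?_).trans (by simp)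
      simp only [Finset.mem_insert, Finset.mem_singleton] at hγ hγ'
      exact (hγ.resolve_right hγ') ▸ h
    · refine (key v {α} fun γ hγ hγ' => ?_).trans (by simp)
      simp only [Finset.mem_insert, Finset.mem_singleton] at hγ hγ'
      exact (hγ.resolve_left hγ') ▸ h
  refine hconn.not_three_ends (x := ⟨x, hxK⟩) (y := ⟨y, hyK⟩) (z := ⟨z, hzK⟩)
    (fun v => (key v {α, β} fun γ hγ hγ' => absurd hγ hγ').trans Finset.card_le_two)
    (fun h => hxy (congrArg Subtype.val h)) (fun h => hxz (congrArg Subtype.val h))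
    (fun h => hyz (congrArg Subtype.val h)) (hend _ hx) (hend _ hy) (hend _ hz)

/-- If `e₁` is an edge at `y` whose color is missing at `x`, and some color is missing at all ends of
`e₁`, then `e₁` can be recolored and its former color be given to the edge `e₀` from `x` to `y`. -/
theorem IsProperOn.exists_extension_of_missing [DecidableEq E] (hc : IsProperOn I s c) {e₀ e₁ : E}
    (he₀ : e₀ ∉ s) (he₁ : e₁ ∈ s) {x y : V} (h₀ : ∀ v, I e₀ v → v = x ∨ v = y) (hy₁ : I e₁ y)
    (hx : IsMissing I s c x (c e₁)) {γ : C} (hγ : ∀ v, I e₁ v → IsMissing I s c v γ) :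
    ∃ c' : E → C, IsProperOn I (insert e₀ s) c' := by
  have hsub : s \ {e₁} ⊆ s := sdiff_subset
  have hs : insert e₁ (s \ {e₁}) = s := insert_sdiff_self_of_mem he₁
  have hne : γ ≠ c e₁ := (hγ y hy₁ e₁ he₁ hy₁).symm
  have hc' : IsProperOn I s (Function.update c e₁ γ) := by
    have := (hc.mono hsub).update_insert (e₀ := e₁) (fun h => h.2 rfl)
      (γ := γ) (fun v hv e he => hγ v hv e (hsub he))
    rwa [hs] at this
  refine ⟨_, hc'.update_insert he₀ (γ := c e₁) fun v hv e he hev => ?_⟩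
  by_cases hee : e = e₁
  · rw [hee, Function.update_self]
    exact hne
  · rw [Function.update_of_ne hee]
    rcases h₀ v hv with rfl | rfl
    · exact hx e he hev
    · exact fun h => hee (hc _ e he e₁ he₁ hev hy₁ h)

theorem Set.exists_pair_of_encard_le_two {A : Set V} (h : A.encard ≤ 2) {x : V} (hx : x ∈ A) :
    A = {x} ∨ ∃ y, y ≠ x ∧ A = {x, y} := by
  by_cases hA : A ⊆ {x}
  · exact Or.inl (hA.antisymm (singleton_subset_iff.2 hx))
  · right
    obtain ⟨y, hy, hyx⟩ := not_subset.1 hA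
    refine ⟨y, hyx, subset_antisymm (fun z hz => ?_) (by rintro _ (rfl | rfl) <;> assumption)⟩
    by_contra hzn
    simp only [mem_insert_iff, mem_singleton_iff, not_or] at hzn
    have h3 : ({x, y, z} : Set V).encard = 3 :=
      Set.encard_eq_three.2 ⟨x, y, z, fun h => hyx h.symm, fun h => hzn.1 h.symm,
        fun h => hzn.2 h.symm, rfl⟩
    have := (Set.encard_le_encard (show ({x, y, z} : Set V) ⊆ A by
      rintro _ (rfl | rfl | rfl) <;> assumption)).trans h
    rw [h3] at this
    exact absurd this (by decide)

/-- The number of colors used at a vertex is at most the number of edges there. -/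
theorem card_used_le [Finite E] (v : V) {U : Finset C}
    (hU : ∀ γ ∈ U, ¬ IsMissing I s c v γ) : U.card ≤ {e | e ∈ s ∧ I e v}.ncard := by
  have : (U : Set C) ⊆ c '' {e | e ∈ s ∧ I e v} := fun γ hγ => by
    have := hU γ hγ
    simp only [IsMissing] at this
    push Not at this
    obtain ⟨e, h1, h2, h3⟩ := this
    exact ⟨e, ⟨h1, h2⟩, h3⟩
  rw [← Set.ncard_coe_finset U]
  exact (Set.ncard_le_ncard this).trans (Set.ncard_image_le (toFinite _))

theorem exists_isMissing [Finite E] [Fintype C] {v : V}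
    (h : {e | e ∈ s ∧ I e v}.ncard < Fintype.card C) : ∃ γ, IsMissing I s c v γ := by
  classical
  by_contra! hno
  exact h.not_ge (card_used_le v (U := Finset.univ) fun γ _ => hno γ)

theorem ncard_incident_lt [Finite E] {D : ℕ} (hD : ∀ v, {e | I e v}.ncard ≤ D) {e₀ : E}
    (he₀ : e₀ ∉ s) {v : V} (hv : I e₀ v) : {e | e ∈ s ∧ I e v}.ncard < D :=
  (Set.ncard_lt_ncard ⟨fun _ he => he.2, fun h => he₀ (h hv).1⟩).trans_le (hD v)

/-- A proper partial coloring of a multigraph with `⌊3D/2⌋` colors can be changed so that it extends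
to one more edge. -/
theorem IsProperOn.exists_extension [Finite E] [Finite V] [Fintype C] {D : ℕ}
    (hC : 3 * D ≤ 2 * Fintype.card C + 1) (h1 : ∀ e, ∃ v, I e v) (h2 : ∀ e, {v | I e v}.encard ≤ 2)
    (hD : ∀ v, {e | I e v}.ncard ≤ D) (hc : IsProperOn I s c) {e₀ : E} (he₀ : e₀ ∉ s) :
    ∃ c' : E → C, IsProperOn I (insert e₀ s) c' := by
  classical
  by_contra hno
  obtain ⟨x, hx₀⟩ := h1 e₀
  have hxlt := ncard_incident_lt hD he₀ hx₀
  have hmiss : ∀ {c : E → C} {v}, I e₀ v → ∃ γ, IsMissing I s c v γ := fun {c v} hv => by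
    have := ncard_incident_lt hD he₀ hv
    exact exists_isMissing (by omega)
  have hext : ∀ {c : E → C}, IsProperOn I s c → ∀ γ, ¬ ∀ v, I e₀ v → IsMissing I s c v γ :=
    fun hc γ hγ => hno ⟨_, hc.update_insert he₀ hγ⟩
  rcases Set.exists_pair_of_encard_le_two (h2 e₀) hx₀ with h | ⟨y, hyx, h⟩
  · obtain ⟨γ, hγ⟩ := hmiss (c := c) hx₀
    refine hext hc γ fun v hv => ?_
    have : v ∈ ({x} : Set V) := h ▸ hv
    rwa [mem_singleton_iff.1 this]
  have h₀ : ∀ v, I e₀ v → v = x ∨ v = y := fun v hv => by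
    have : v ∈ ({x, y} : Set V) := h ▸ hv
    simpa using this
  have hy₀ : I e₀ y := by
    have : y ∈ {v | I e₀ v} := h ▸ mem_insert_of_mem _ rfl
    exact this
  have hylt := ncard_incident_lt hD he₀ hy₀
  have hext' : ∀ {c : E → C}, IsProperOn I s c → ∀ γ, IsMissing I s c x γ →
      ¬ IsMissing I s c y γ := fun hc γ hγx hγy =>
    hext hc γ fun v hv => by rcases h₀ v hv with rfl | rfl <;> assumption
  obtain ⟨β, hβ⟩ := hmiss (c := c) hx₀
  have hβy := hext' hc β hβ
  simp only [IsMissing] at hβy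
  push Not at hβy
  obtain ⟨e₁, he₁, hy₁, rfl⟩ := hβy
  rcases Set.exists_pair_of_encard_le_two (h2 e₁) hy₁ with h | ⟨z, hzy, h⟩
  · obtain ⟨γ, hγ⟩ := hmiss (c := c) hy₀
    refine hno (hc.exists_extension_of_missing he₀ he₁ h₀ hy₁ hβ (γ := γ) fun v hv => ?_)
    have : v ∈ ({y} : Set V) := h ▸ hv
    rwa [mem_singleton_iff.1 this]
  have hz₁ : I e₁ z := by
    have : z ∈ {v | I e₁ v} := h ▸ mem_insert_of_mem _ rfl
    exact this
  have hzx : z ≠ x := fun h => hβ e₁ he₁ (h ▸ hz₁) rfl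
  have hyz : ∀ {c : E → C}, IsProperOn I s c → IsMissing I s c x (c e₁) → ∀ γ,
      IsMissing I s c y γ → ¬ IsMissing I s c z γ := fun hc hβ γ hγy hγz =>
    hno (hc.exists_extension_of_missing he₀ he₁ h₀ hy₁ hβ (γ := γ) fun v hv => by
      have : v ∈ ({y, z} : Set V) := h ▸ hv
      rcases this with rfl | rfl <;> assumption)
  have hxz : ∀ γ, IsMissing I s c x γ → ¬ IsMissing I s c z γ := by
    intro γ hγx hγz
    obtain ⟨δ, hδ⟩ := hmiss (c := c) hy₀
    have hβγ : c e₁ ≠ γ := hγz e₁ he₁ hz₁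
    have hβδ : c e₁ ≠ δ := hδ e₁ he₁ hy₁
    by_cases hxy : x ∈ ((kempeGraph I s c γ δ).connectedComponentMk y).supp
    · have hzK : y ∉ ((kempeGraph I s c γ δ).connectedComponentMk z).supp ∧
          x ∉ ((kempeGraph I s c γ δ).connectedComponentMk z).supp := by
        have hzy' : z ∉ ((kempeGraph I s c γ δ).connectedComponentMk y).supp := fun hz =>
          hc.not_three_ends h2 _ hyx.symm hzx.symm hzy.symm hxy rfl hz (Or.inl hγx) (Or.inr hδ)
            (Or.inl hγz)
        rw [SimpleGraph.ConnectedComponent.mem_supp_iff] at hxy hzy'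
        constructor
        · intro h
          exact hzy' (SimpleGraph.ConnectedComponent.mem_supp_iff _ _ |>.1 h).symm
        · intro h
          exact hzy' ((SimpleGraph.ConnectedComponent.mem_supp_iff _ _ |>.1 h).symm.trans hxy)
      have hT := isKempeClosed_supp ((kempeGraph I s c γ δ).connectedComponentMk z)
      have hzT : z ∈ ((kempeGraph I s c γ δ).connectedComponentMk z).supp := rfl
      have hce₁ : kempeSwap I γ δ ((kempeGraph I s c γ δ).connectedComponentMk z).supp c e₁ =
          c e₁ := hT.kempeSwap_of_notMem he₁ hzK.1 hy₁
      refine hyz (hT.isProperOn hc) ?_ δ (hδ.kempeSwap_of_notMem hT hzK.1) ?_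
      · rw [hce₁]
        exact hβ.kempeSwap_of_notMem hT hzK.2
      · have := hγz.kempeSwap_of_mem (α := γ) (β := δ) hzT
        rwa [Equiv.swap_apply_left] at this
    · have hT := isKempeClosed_supp ((kempeGraph I s c γ δ).connectedComponentMk y)
      refine hext' (hT.isProperOn hc) γ (hγx.kempeSwap_of_notMem hT hxy) ?_
      have := hδ.kempeSwap_of_mem (α := γ) (β := δ)
        (show y ∈ ((kempeGraph I s c γ δ).connectedComponentMk y).supp from rfl)
      rwa [Equiv.swap_apply_right] at this
  -- every color is used at two of the three vertices
  have hzle : {e | e ∈ s ∧ I e z}.ncard ≤ D :=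
    (Set.ncard_le_ncard fun _ he => he.2).trans (hD z)
  let U : V → Finset C := fun v => Finset.univ.filter fun γ => ¬ IsMissing I s c v γ
  have hU : ∀ v, (U v).card ≤ {e | e ∈ s ∧ I e v}.ncard := fun v =>
    card_used_le v fun γ hγ => (Finset.mem_filter.1 hγ).2
  have hsum : 2 * Fintype.card C ≤ (U x).card + (U y).card + (U z).card := by
    simp only [U, Finset.card_filter]
    rw [← Finset.sum_add_distrib, ← Finset.sum_add_distrib, mul_comm, ← smul_eq_mul,
      ← Finset.card_univ, ← Finset.sum_const]
    refine Finset.sum_le_sum fun γ _ => ?_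
    have a1 := hext' hc γ
    have a2 := hyz hc hβ γ
    have a3 := hxz γ
    by_cases b1 : IsMissing I s c x γ <;> by_cases b2 : IsMissing I s c y γ <;>
      by_cases b3 : IsMissing I s c z γ <;> simp_all
  have := hU x
  have := hU y
  have := hU z
  omega

/-- **Shannon's theorem**: a multigraph of maximum degree `D` has a proper edge coloring with
`⌊3D/2⌋` colors. Edges with only one end are allowed. -/
theorem exists_isProperOn_univ [Finite E] [Finite V] (I : E → V → Prop) (h1 : ∀ e, ∃ v, I e v)
    (h2 : ∀ e, {v | I e v}.encard ≤ 2) {D : ℕ} (hD : ∀ v, {e | I e v}.ncard ≤ D) :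
    ∃ c : E → Fin (3 * D / 2), IsProperOn I univ c := by
  classical
  have hex : Nonempty (E → Fin (3 * D / 2)) := by
    by_cases hE : Nonempty E
    · obtain ⟨e⟩ := hE
      obtain ⟨v, hv⟩ := h1 e
      have : 0 < {e | I e v}.ncard := (Set.ncard_pos).2 ⟨e, hv⟩
      have := hD v
      exact ⟨fun _ => ⟨0, by omega⟩⟩
    · exact ⟨fun e => absurd ⟨e⟩ hE⟩
  have key : ∀ s : Set E, s.Finite → ∃ c : E → Fin (3 * D / 2), IsProperOn I s c := by
    intro s hs
    induction s, hs using Set.Finite.induction_on with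
    | empty =>
      obtain ⟨c⟩ := hex
      exact ⟨c, fun v e he => absurd he (notMem_empty e)⟩
    | @insert e s he _ ih =>
      obtain ⟨c, hc⟩ := ih
      exact hc.exists_extension (by rw [Fintype.card_fin]; omega) h1 h2 hD he
  exact key univ (toFinite _)

end EdgeColoring

theorem IsArc.symm {u v : ℂ} {e : Set ℂ} (h : IsArc u v e) : IsArc v u e := by
  obtain ⟨γ, hγ, rfl⟩ := h
  exact ⟨γ.symm, hγ.comp unitInterval.symm_bijective.injective, γ.symm_range⟩

theorem IsArc.ne {u v : ℂ} {e : Set ℂ} (h : IsArc u v e) : u ≠ v := by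
  obtain ⟨γ, hγ, rfl⟩ := h
  intro huv
  have : (0 : unitInterval) = 1 := hγ (by rw [γ.source, γ.target, huv])
  exact zero_ne_one this

theorem IsArc.source_mem {u v : ℂ} {e : Set ℂ} (h : IsArc u v e) : u ∈ e := by
  obtain ⟨γ, -, rfl⟩ := h
  exact ⟨0, γ.source⟩

theorem IsArc.target_mem {u v : ℂ} {e : Set ℂ} (h : IsArc u v e) : v ∈ e :=
  h.symm.source_mem

theorem IsArc.isPreconnected {u v : ℂ} {e : Set ℂ} (h : IsArc u v e) : IsPreconnected e := by
  obtain ⟨γ, -, rfl⟩ := h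
  exact isPreconnected_range γ.continuous

theorem isArc_subpath {u v : ℂ} {γ : Path u v} (hγ : Function.Injective γ) {s t : unitInterval}
    (hst : s < t) : IsArc (γ s) (γ t) (γ '' Icc s t) := by
  refine ⟨γ.subpath s t, hγ.comp fun x y hxy => Subtype.ext ?_, γ.range_subpath_of_le s t hst.le⟩
  have h := congrArg Subtype.val hxy
  simp only [Icc.coe_convexComb] at h
  have h' : ((t : ℝ) - s) ≠ 0 := (sub_pos.2 (show (s : ℝ) < t from hst)).ne'
  apply mul_left_cancel₀ h'
  linear_combination h

/-- An inner point of an arc divides it into two arcs. -/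
theorem IsArc.split {u v w : ℂ} {e : Set ℂ} (h : IsArc u v e) (hw : w ∈ e) (hwu : w ≠ u)
    (hwv : w ≠ v) : ∃ e₁ e₂, IsArc u w e₁ ∧ IsArc w v e₂ ∧ e₁ ∪ e₂ = e ∧ e₁ ∩ e₂ = {w} := by
  obtain ⟨γ, hγ, rfl⟩ := h
  obtain ⟨t, rfl⟩ := hw
  have ht0 : 0 < t := bot_lt_iff_ne_bot.2 fun h => hwu ((congrArg γ h).trans γ.source)
  have ht1 : t < 1 := lt_top_iff_ne_top.2 fun h => hwv ((congrArg γ h).trans γ.target)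
  refine ⟨γ '' Icc 0 t, γ '' Icc t 1, ?_, ?_, ?_, ?_⟩
  · simpa using isArc_subpath hγ ht0
  · simpa using isArc_subpath hγ ht1
  · rw [← image_union, Icc_union_Icc_eq_Icc ht0.le ht1.le, ← image_univ]
    congr 1
    exact eq_univ_of_forall fun x => ⟨bot_le, le_top⟩
  · rw [← image_inter hγ, Icc_inter_Icc, sup_of_le_right ht0.le, inf_of_le_left ht1.le, Icc_self,
      image_singleton]

/-- An inner point of an arc is a limit of points outside the arc. -/
theorem IsArc.mem_closure_compl {u v w : ℂ} {e : Set ℂ} (h : IsArc u v e) (hw : w ∈ e)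
    (hwu : w ≠ u) (hwv : w ≠ v) : w ∈ closure eᶜ := by
  obtain ⟨e₁, e₂, h₁, h₂, hun, hin⟩ := h.split hw hwu hwv
  rw [closure_compl, mem_compl_iff, mem_interior_iff_mem_nhds, Metric.mem_nhds_iff]
  rintro ⟨r, hr, hball⟩
  have hmeet : ∀ e', IsPreconnected e' → e'.Nontrivial → w ∈ e' →
      ({z : ℂ | ‖z - w‖ ∈ Ioo 0 r} ∩ e').Nonempty := by
    intro e' hc hnt hwe
    obtain ⟨y, ⟨hyr, hye⟩, hyw⟩ :=
      accPt_iff_nhds.1 (hc.preperfect_of_nontrivial hnt w hwe) _ (Metric.ball_mem_nhds w hr)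
    exact ⟨y, ⟨norm_pos_iff.2 (sub_ne_zero.2 hyw), by rwa [← dist_eq_norm]⟩, hye⟩
  have hP : IsPreconnected {z : ℂ | ‖z - w‖ ∈ Ioo 0 r} :=
    isPreconnected_norm_sub_mem w isPreconnected_Ioo fun t ht => ht.1.le
  obtain ⟨z, hzP, hz⟩ := isPreconnected_closed_iff.1 hP e₁ e₂ h₁.isCompact.isClosed
    h₂.isCompact.isClosed (fun z hz => hun ▸ hball (by rw [Metric.mem_ball, dist_eq_norm]; exact hz.2))
    (hmeet e₁ h₁.isPreconnected ⟨u, h₁.source_mem, w, h₁.target_mem, h₁.ne⟩ h₁.target_mem)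
    (hmeet e₂ h₂.isPreconnected ⟨w, h₂.source_mem, v, h₂.target_mem, h₂.ne⟩ h₂.source_mem)
  rw [hin, mem_singleton_iff] at hz
  have := hzP.1
  rw [hz, sub_self, norm_zero] at this
  exact lt_irrefl _ this

namespace PlaneGraph

variable {G R : PlaneGraph}

theorem isCompact_edge {e : Set ℂ} (he : e ∈ R.edges) : IsCompact e := by
  obtain ⟨u, v, h, -⟩ := R.edge_isArc e he
  exact h.isCompact

theorem isCompact_support (R : PlaneGraph) : IsCompact R.support :=
  R.verts_finite.isCompact.union (R.edges_finite.isCompact_sUnion fun _ he => isCompact_edge he)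

theorem eq_connectedComponentIn_of_mem {f : Set ℂ} (hf : f ∈ R.faces) {x : ℂ} (hx : x ∈ f) :
    f = connectedComponentIn R.supportᶜ x := by
  obtain ⟨y, -, rfl⟩ := hf
  exact connectedComponentIn_eq hx

theorem disjoint_support_of_mem_faces {f : Set ℂ} (hf : f ∈ R.faces) : f ⊆ R.supportᶜ := by
  obtain ⟨y, -, rfl⟩ := hf
  exact connectedComponentIn_subset _ _

theorem isOpen_of_mem_faces {f : Set ℂ} (hf : f ∈ R.faces) : IsOpen f := by
  obtain ⟨y, -, rfl⟩ := hf
  exact R.isCompact_support.isClosed.isOpen_compl.connectedComponentIn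

theorem mem_frontier_of_mem_support {f : Set ℂ} (hf : f ∈ R.faces) {w : ℂ} (hw : w ∈ R.support) :
    w ∈ frontier f ↔ w ∈ closure f := by
  rw [(isOpen_of_mem_faces hf).frontier_eq]
  exact ⟨fun h => h.1, fun h => ⟨h, fun h' => disjoint_support_of_mem_faces hf h' hw⟩⟩

/-- Near a point in the interior of an edge there are at most two faces, and the point lies on the
boundary of one of them. -/
theorem faces_at_edge {w : ℂ} (hw : w ∈ R.support) (hwV : w ∉ R.verts) :
    {f ∈ R.faces | w ∈ frontier f}.encard ≤ 2 ∧ {f ∈ R.faces | w ∈ frontier f}.Nonempty := by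
  obtain ⟨e, he, hwe⟩ := hw.resolve_left hwV
  obtain ⟨u, v, harc, huv⟩ := R.edge_isArc e he
  let K := R.verts ∪ ⋃₀ (R.edges \ {e})
  have hK : IsCompact K := R.verts_finite.isCompact.union
    ((R.edges_finite.subset sdiff_subset).isCompact_sUnion fun _ h => isCompact_edge h.1)
  have hsupp : K ∪ e = R.support := by
    rw [support, union_assoc, union_comm _ e, ← sUnion_insert e, insert_sdiff_self_of_mem he]
  have hKe : K ∩ e ⊆ {u, v} := by
    rw [← huv]
    rintro z ⟨hz | ⟨e', ⟨he', hne⟩, hz⟩, hze⟩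
    · exact ⟨hze, hz⟩
    · exact ⟨hze, R.edge_inter e' he' e he hne ⟨hz, hze⟩⟩
  have hwuv : w ∉ ({u, v} : Set ℂ) := fun h => hwV (huv ▸ h : w ∈ e ∩ R.verts).2
  simp only [mem_insert_iff, mem_singleton_iff, not_or] at hwuv
  have hwK : w ∉ K := fun h => by
    have := hKe ⟨h, hwe⟩
    simp [hwuv] at this
  obtain ⟨r, hr, hball⟩ := Metric.isOpen_iff.1 hK.isClosed.isOpen_compl w hwK
  let T : Set (Set ℂ) := {f ∈ R.faces | (f ∩ Metric.ball w r).Nonempty}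
  have hT : T.encard ≤ 2 := by
    by_contra! hlt
    have h3 : (3 : ℕ∞) ≤ T.encard := Order.add_one_le_of_lt hlt
    obtain ⟨t, htT, ht⟩ := Set.exists_subset_encard_eq h3
    obtain ⟨f, g, h, hfg, hfh, hgh, rfl⟩ := Set.encard_eq_three.1 ht
    have hF : ∀ i, (![f, g, h] : Fin 3 → Set ℂ) i ∈ T := by
      intro i
      fin_cases i
      · exact htT (by simp)
      · exact htT (by simp)
      · exact htT (by simp)
    choose a ha using fun i => (hF i).2
    refine connectedComponentIn_union_arc hK harc hKe (convex_ball w r).isPreconnected hball a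
      (fun i => (ha i).2) (fun i hi => disjoint_support_of_mem_faces (hF i).1 (ha i).1
        (hsupp ▸ Or.inr hi)) ?_
    rw [hsupp]
    simp only [← eq_connectedComponentIn_of_mem (hF _).1 (ha _).1]
    intro i j hij
    fin_cases i <;> fin_cases j <;> simp_all [eq_comm]
  have hfin : T.Finite := Set.finite_of_encard_le_coe (k := 2) hT
  constructor
  · refine (Set.encard_le_encard (show {f ∈ R.faces | w ∈ frontier f} ⊆ T from
      fun f hf => ⟨hf.1, ?_⟩)).trans hT
    rw [inter_comm]
    exact mem_closure_iff_nhds.1 hf.2.1 _ (Metric.ball_mem_nhds w hr)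
  · have hcl : w ∈ closure (⋃ f ∈ T, f) := by
      refine mem_closure_iff_nhds.2 fun U hU => ?_
      obtain ⟨z, ⟨hzU, hzB⟩, hze⟩ := mem_closure_iff_nhds.1
        (harc.mem_closure_compl hwe hwuv.1 hwuv.2) _
        (Filter.inter_mem hU (Metric.ball_mem_nhds w hr))
      have hz : z ∈ R.supportᶜ := by
        rw [← hsupp]
        exact fun h => h.elim (hball hzB) hze
      have hzf : z ∈ connectedComponentIn R.supportᶜ z := mem_connectedComponentIn hz
      exact ⟨z, hzU, mem_biUnion (show connectedComponentIn R.supportᶜ z ∈ T from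
        ⟨⟨z, hz, rfl⟩, z, hzf, hzB⟩) hzf⟩
    rw [hfin.closure_biUnion] at hcl
    obtain ⟨f, hf, hwf⟩ := mem_iUnion₂.1 hcl
    exact ⟨f, hf.1, (mem_frontier_of_mem_support hf.1 hw).2 hwf⟩

theorem faces_nonempty (R : PlaneGraph) : R.faces.Nonempty := by
  obtain ⟨x, hx⟩ := nonempty_compl.2 R.isCompact_support.ne_univ
  exact ⟨_, x, hx, rfl⟩

theorem IsSubdivision.support_eq (h : G.IsSubdivision R) : G.support = R.support := by
  induction h with
  | refl => rfl
  | tail _ hstep ih => rw [hstep.support_eq, ih]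

theorem IsSubdivision.verts_subset (h : G.IsSubdivision R) : R.verts ⊆ G.verts := by
  induction h with
  | refl => rfl
  | tail _ hstep ih =>
    obtain ⟨e, he, u, v, w, e₁, e₂, -, -, -, -, -, -, -, hV, -⟩ := hstep
    rw [hV]
    exact ih.trans (subset_insert _ _)

theorem IsCyclicColoring.cyclicChromaticNumber_le {C : Type} [Fintype C] {c : G.verts → C}
    (hc : G.IsCyclicColoring c) : G.cyclicChromaticNumber ≤ Fintype.card C := by
  refine Nat.sInf_le ⟨fun v => Fintype.equivFin C (c v), ?_⟩
  intro f hf u v hu hv huv h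
  exact hc f hf u v hu hv huv ((Fintype.equivFin C).injective h)

theorem exists_isCyclicColoring (G : PlaneGraph) :
    ∃ c : G.verts → Fin G.cyclicChromaticNumber, G.IsCyclicColoring c := by
  have := G.verts_finite.to_subtype
  refine Nat.sInf_mem (s := {k : ℕ | ∃ c : G.verts → Fin k, G.IsCyclicColoring c})
    ⟨Nat.card G.verts, Finite.equivFin G.verts, ?_⟩
  intro f _ u v _ _ huv h
  exact huv ((Finite.equivFin G.verts).injective h)

theorem faceDegree_sub_of_verts_subset (h : R.verts ⊆ G.verts) (f : Set ℂ) :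
    (G.faceDegree f : ℤ) - R.faceDegree f = ((G.verts \ R.verts) ∩ frontier f).ncard := by
  have hfin : (R.faceVerts f).Finite := R.verts_finite.inter_of_left _
  have hsub : R.faceVerts f ⊆ G.faceVerts f := inter_subset_inter_left _ h
  have heq : (G.verts \ R.verts) ∩ frontier f = G.faceVerts f \ R.faceVerts f := by
    ext z
    simp only [faceVerts, mem_inter_iff, mem_sdiff]
    tauto
  have := Set.ncard_sdiff_add_ncard_of_subset hsub (G.verts_finite.inter_of_left _)
  rw [heq, faceDegree, faceDegree]
  omega

theorem IsSubdivision.exists_isGreatest (h : G.IsSubdivision R) :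
    ∃ M : ℕ, IsGreatest (G.degreeDifferences R) M := by
  obtain ⟨M, hM, hle⟩ := Int.exists_greatest_of_bdd (P := fun d => d ∈ G.degreeDifferences R)
    ⟨G.verts.ncard, by
      rintro _ ⟨f, hf, rfl⟩
      have : G.faceDegree f ≤ G.verts.ncard := Set.ncard_le_ncard inter_subset_left G.verts_finite
      omega⟩
    (by
      obtain ⟨f, hf⟩ := G.faces_nonempty
      exact ⟨_, f, hf, rfl⟩)
  have hM0 : 0 ≤ M := by
    obtain ⟨f, hf, rfl⟩ := hM
    rw [faceDegree_sub_of_verts_subset h.verts_subset]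
    exact Int.natCast_nonneg _
  lift M to ℕ using hM0
  exact ⟨M, hM, fun d hd => hle d hd⟩

theorem IsSubdivision.cyclicChromaticNumber_le (h : G.IsSubdivision R) {M : ℕ}
    (hM : IsGreatest (G.degreeDifferences R) M) :
    G.cyclicChromaticNumber ≤ 3 * M / 2 + R.cyclicChromaticNumber := by
  classical
  let N : Set ℂ := G.verts \ R.verts
  have hN : N.Finite := G.verts_finite.subset sdiff_subset
  have hNat : ∀ w ∈ N, {f ∈ R.faces | w ∈ frontier f}.encard ≤ 2 ∧
      {f ∈ R.faces | w ∈ frontier f}.Nonempty := fun w hw =>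
    faces_at_edge (h.support_eq ▸ Or.inl hw.1) hw.2
  let F : Set (Set ℂ) := {f ∈ R.faces | ∃ w ∈ N, w ∈ frontier f}
  have hF : F.Finite := by
    refine (hN.biUnion fun w hw => Set.finite_of_encard_le_coe (k := 2) (hNat w hw).1).subset ?_
    rintro f ⟨hf, w, hw, hwf⟩
    exact mem_biUnion hw ⟨hf, hwf⟩
  have := hN.to_subtype
  have := hF.to_subtype
  obtain ⟨c, hc⟩ := exists_isProperOn_univ (fun (w : N) (f : F) => (w : ℂ) ∈ frontier (f : Set ℂ))
    (D := M) (fun w => by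
      obtain ⟨f, hf, hwf⟩ := (hNat w w.2).2
      exact ⟨⟨f, hf, w, w.2, hwf⟩, hwf⟩)
    (fun w => by
      rw [← Subtype.val_injective.encard_image]
      refine (Set.encard_le_encard ?_).trans (hNat w w.2).1
      rintro _ ⟨f, hf, rfl⟩
      exact ⟨f.2.1, hf⟩)
    (fun f => by
      have hle := hM.2 ⟨f, h.faces_eq ▸ f.2.1, rfl⟩
      rw [faceDegree_sub_of_verts_subset h.verts_subset] at hle
      have hle' : ((G.verts \ R.verts) ∩ frontier (f : Set ℂ)).ncard ≤ M := by exact_mod_cast hle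
      rw [← Set.ncard_image_of_injective _ Subtype.val_injective]
      refine (Set.ncard_le_ncard ?_ (hN.inter_of_left _)).trans hle'
      rintro _ ⟨w, hw, rfl⟩
      exact ⟨w.2, hw⟩)
  obtain ⟨d, hd⟩ := R.exists_isCyclicColoring
  let col : G.verts → Fin (3 * M / 2) ⊕ Fin R.cyclicChromaticNumber := fun v =>
    if hv : (v : ℂ) ∈ R.verts then Sum.inr (d ⟨v, hv⟩) else Sum.inl (c ⟨v, v.2, hv⟩)
  have hcol : G.IsCyclicColoring col := by
    intro f hf u v hu hv huv heq
    have hf' : f ∈ R.faces := h.faces_eq ▸ hf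
    by_cases hu' : (u : ℂ) ∈ R.verts <;> by_cases hv' : (v : ℂ) ∈ R.verts <;>
      simp only [col, hu', hv', dite_true, dite_false, reduceCtorEq, Sum.inr.injEq,
        Sum.inl.injEq] at heq
    · exact hd f hf' ⟨u, hu'⟩ ⟨v, hv'⟩ ⟨hu', hu.2⟩ ⟨hv', hv.2⟩
        (fun h => huv (Subtype.ext (Subtype.mk.inj h))) heq
    · have := hc ⟨f, hf', u, ⟨u.2, hu'⟩, hu.2⟩ ⟨u, u.2, hu'⟩ trivial ⟨v, v.2, hv'⟩ trivial hu.2 hv.2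
        heq
      exact huv (Subtype.ext (Subtype.mk.inj this))
  simpa using hcol.cyclicChromaticNumber_le

theorem floor_three_halves (M : ℕ) : ⌊(3 / 2 : ℝ) * ((M : ℤ) : ℝ)⌋ = ((3 * M / 2 : ℕ) : ℤ) := by
  rw [Int.floor_eq_iff]
  have h1 : 2 * (3 * M / 2) ≤ 3 * M := Nat.mul_div_le _ _
  have h2 : 3 * M < 2 * (3 * M / 2) + 2 := by omega
  have h1' : (2 : ℝ) * ((3 * M / 2 : ℕ) : ℝ) ≤ 3 * M := by exact_mod_cast h1
  have h2' : (3 : ℝ) * M < 2 * ((3 * M / 2 : ℕ) : ℝ) + 2 := by exact_mod_cast h2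
  constructor
  · rw [Int.cast_natCast, Int.cast_natCast]
    linarith
  · rw [Int.cast_natCast, Int.cast_natCast]
    linarith

/-- Every point on an edge can be made a vertex by a subdivision. -/
theorem exists_subdivisionStep {w : ℂ} (hw : w ∈ R.support) (hwV : w ∉ R.verts) :
    ∃ G : PlaneGraph, SubdivisionStep R G ∧ G.verts = insert w R.verts := by
  obtain ⟨e, he, hwe⟩ := hw.resolve_left hwV
  obtain ⟨u, v, harc, huv⟩ := R.edge_isArc e he
  have hwuv : w ∉ ({u, v} : Set ℂ) := fun h => hwV (huv ▸ h : w ∈ e ∩ R.verts).2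
  simp only [mem_insert_iff, mem_singleton_iff, not_or] at hwuv
  obtain ⟨e₁, e₂, h₁, h₂, hun, hin⟩ := harc.split hwe hwuv.1 hwuv.2
  have hsub : ∀ e' ∈ ({e₁, e₂} : Set (Set ℂ)), e' ⊆ e := by
    rintro e' (rfl | rfl)
    · exact hun ▸ subset_union_left
    · exact hun ▸ subset_union_right
  have hold : ∀ e' ∈ R.edges \ {e}, e' ∩ e ⊆ R.verts := fun e' he' =>
    R.edge_inter e' he'.1 e he he'.2
  have hwold : ∀ e' ∈ R.edges \ {e}, w ∉ e' := fun e' he' h => hwV (hold e' he' ⟨h, hwe⟩)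
  have hu : u ∈ R.verts := (huv.symm ▸ Or.inl rfl : u ∈ e ∩ R.verts).2
  have hv : v ∈ R.verts := (huv.symm ▸ Or.inr rfl : v ∈ e ∩ R.verts).2
  have hend : ∀ z ∈ e, z ∈ R.verts → z = u ∨ z = v := fun z hz hz' =>
    (huv ▸ ⟨hz, hz'⟩ : z ∈ ({u, v} : Set ℂ))
  have hv₁ : v ∉ e₁ := fun h => hwuv.2 (hin ▸ ⟨h, h₂.target_mem⟩ : v ∈ ({w} : Set ℂ)).symm
  have hu₂ : u ∉ e₂ := fun h => hwuv.1 (hin ▸ ⟨h₁.source_mem, h⟩ : u ∈ ({w} : Set ℂ)).symm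
  have hmixed : ∀ e' ∈ R.edges \ {e}, ∀ e'' ∈ ({e₁, e₂} : Set (Set ℂ)),
      e' ∩ e'' ⊆ insert w R.verts := fun e' he' e'' he'' z hz =>
    Or.inr (hold e' he' ⟨hz.1, hsub e'' he'' hz.2⟩)
  refine ⟨⟨insert w R.verts, (R.edges \ {e}) ∪ {e₁, e₂}, R.verts_finite.insert w,
    (R.edges_finite.subset sdiff_subset).union (by simp), ?_, ?_⟩,
    ⟨e, he, u, v, w, e₁, e₂, huv, hwe, hwV, h₁, h₂, hun, hin, rfl, rfl⟩, rfl⟩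
  · rintro e' (he' | rfl | rfl)
    · obtain ⟨x, y, hxy, hxy'⟩ := R.edge_isArc e' he'.1
      exact ⟨x, y, hxy, by rw [inter_insert_of_notMem (hwold e' he'), hxy']⟩
    · refine ⟨u, w, h₁, ?_⟩
      ext z
      constructor
      · rintro ⟨hz, rfl | hz'⟩
        · exact Or.inr rfl
        · rcases hend z (hsub _ (Or.inl rfl) hz) hz' with rfl | rfl
          · exact Or.inl rfl
          · exact absurd hz hv₁
      · rintro (rfl | rfl)
        · exact ⟨h₁.source_mem, Or.inr hu⟩
        · exact ⟨h₁.target_mem, Or.inl rfl⟩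
    · refine ⟨w, v, h₂, ?_⟩
      ext z
      constructor
      · rintro ⟨hz, rfl | hz'⟩
        · exact Or.inl rfl
        · rcases hend z (hsub _ (Or.inr rfl) hz) hz' with rfl | rfl
          · exact absurd hz hu₂
          · exact Or.inr rfl
      · rintro (rfl | rfl)
        · exact ⟨h₂.source_mem, Or.inl rfl⟩
        · exact ⟨h₂.target_mem, Or.inr hv⟩
  · rintro e' (he' | he') e'' (he'' | he'') hne
    · exact (R.edge_inter e' he'.1 e'' he''.1 hne).trans (subset_insert _ _)
    · exact hmixed e' he' e'' he''
    · rw [inter_comm]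
      exact hmixed e'' he'' e' he'
    · rcases he' with rfl | rfl <;> rcases he'' with rfl | rfl
      · exact absurd rfl hne
      · rw [hin]
        exact singleton_subset_iff.2 (Or.inl rfl)
      · rw [inter_comm, hin]
        exact singleton_subset_iff.2 (Or.inl rfl)
      · exact absurd rfl hne

/-- Every finite set of points on the edges can be made vertices by a subdivision. -/
theorem exists_isSubdivision (R : PlaneGraph) {W : Set ℂ} (hW : W.Finite) (hWR : W ⊆ R.support) :
    ∃ G : PlaneGraph, G.IsSubdivision R ∧ G.verts = R.verts ∪ W := by
  induction W, hW using Set.Finite.induction_on with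
  | empty => exact ⟨R, Relation.ReflTransGen.refl, (union_empty _).symm⟩
  | @insert w W _ _ ih =>
    obtain ⟨G, hG, hV⟩ := ih ((subset_insert _ _).trans hWR)
    by_cases hw : w ∈ G.verts
    · refine ⟨G, hG, ?_⟩
      rw [union_insert, ← hV, insert_eq_of_mem hw]
    · obtain ⟨G', hstep, hV'⟩ := exists_subdivisionStep
        (hG.support_eq.symm ▸ hWR (mem_insert w W)) hw
      exact ⟨G', hG.tail hstep, by rw [hV', hV, union_insert]⟩

/-- If any two vertices share a face, then all vertices receive different colors. -/
theorem cyclicChromaticNumber_eq_ncard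
    (h : ∀ u ∈ G.verts, ∀ v ∈ G.verts, ∃ f ∈ G.faces, u ∈ frontier f ∧ v ∈ frontier f) :
    G.cyclicChromaticNumber = G.verts.ncard := by
  have := G.verts_finite.to_subtype
  have := Fintype.ofFinite G.verts
  rw [← Nat.card_coe_set_eq, Nat.card_eq_fintype_card]
  refine le_antisymm ?_ ?_
  · exact IsCyclicColoring.cyclicChromaticNumber_le (c := id) fun _ _ _ _ _ _ huv => huv
  · obtain ⟨c, hc⟩ := G.exists_isCyclicColoring
    have hinj : Function.Injective c := by
      intro u v huv
      by_contra hne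
      obtain ⟨f, hf, hu, hv⟩ := h u u.2 v v.2
      exact hc f hf u v ⟨u.2, hu⟩ ⟨v.2, hv⟩ hne huv
    simpa using Fintype.card_le_of_injective c hinj

end PlaneGraph

theorem isArc_segment {p q : ℂ} (h : p ≠ q) : IsArc p q (segment ℝ p q) := by
  refine ⟨⟨⟨fun t => AffineMap.lineMap p q (t : ℝ), by fun_prop⟩, by simp, by simp⟩, ?_, ?_⟩
  · intro s t hst
    exact Subtype.ext (AffineMap.lineMap_injective ℝ h hst)
  · rw [segment_eq_image_lineMap]
    ext z
    constructor
    · rintro ⟨t, rfl⟩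
      exact ⟨t, t.2, rfl⟩
    · rintro ⟨t, ht, rfl⟩
      exact ⟨⟨t, ht⟩, rfl⟩

namespace Tetrahedron

/-- The three outer vertices of a straight-line drawing of `K₄` whose inner vertex is `0`. -/
noncomputable def outer : Fin 3 → ℂ := ![1, Complex.I, -1 - Complex.I]

noncomputable def vertexSet : Set ℂ := insert 0 (range outer)

/-- The edges of `K₄`, as sets of points. -/
noncomputable def edgeSet : Set (Set ℂ) :=
  {e | ∃ p ∈ vertexSet, ∃ q ∈ vertexSet, p ≠ q ∧ e = segment ℝ p q}

theorem mem_vertexSet {z : ℂ} : z ∈ vertexSet ↔ (z.re = 0 ∧ z.im = 0) ∨ (z.re = 1 ∧ z.im = 0) ∨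
    (z.re = 0 ∧ z.im = 1) ∨ (z.re = -1 ∧ z.im = -1) := by
  simp only [vertexSet, outer, mem_insert_iff, mem_range, Fin.exists_fin_succ, Complex.ext_iff]
  simp [eq_comm]

theorem mem_segment_iff {z p q : ℂ} : z ∈ segment ℝ p q ↔ ∃ t : ℝ, 0 ≤ t ∧ t ≤ 1 ∧
    z.re = p.re + t * (q.re - p.re) ∧ z.im = p.im + t * (q.im - p.im) := by
  rw [segment_eq_image_lineMap]
  simp only [mem_image, mem_Icc, Complex.ext_iff, AffineMap.lineMap_apply, vsub_eq_sub, vadd_eq_add,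
    Complex.add_re, Complex.add_im, Complex.real_smul, Complex.re_ofReal_mul,
    Complex.im_ofReal_mul, Complex.sub_re, Complex.sub_im]
  constructor
  · rintro ⟨t, ⟨h0, h1⟩, h2, h3⟩
    exact ⟨t, h0, h1, by linarith, by linarith⟩
  · rintro ⟨t, h0, h1, h2, h3⟩
    exact ⟨t, ⟨h0, h1⟩, by linarith, by linarith⟩

theorem vertexSet_eq : vertexSet = {0, 1, Complex.I, -1 - Complex.I} := by
  ext z
  simp only [mem_vertexSet, mem_insert_iff, mem_singleton_iff, Complex.ext_iff]
  simp

/-- The six segments in coordinates. -/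
def side : Fin 6 → Set ℂ :=
  ![{z | z.im = 0 ∧ 0 ≤ z.re ∧ z.re ≤ 1}, {z | z.re = 0 ∧ 0 ≤ z.im ∧ z.im ≤ 1},
    {z | z.re = z.im ∧ -1 ≤ z.re ∧ z.re ≤ 0}, {z | z.re + z.im = 1 ∧ 0 ≤ z.im ∧ z.im ≤ 1},
    {z | z.im = 2 * z.re + 1 ∧ -1 ≤ z.re ∧ z.re ≤ 0},
    {z | z.re = 2 * z.im + 1 ∧ -1 ≤ z.im ∧ z.im ≤ 0}]

noncomputable def sideEnds : Fin 6 → ℂ × ℂ :=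
  ![(0, 1), (0, Complex.I), (0, -1 - Complex.I), (1, Complex.I), (Complex.I, -1 - Complex.I),
    (1, -1 - Complex.I)]

theorem segment_sideEnds (k : Fin 6) :
    segment ℝ (sideEnds k).1 (sideEnds k).2 = side k := by
  ext z
  rw [mem_segment_iff]
  constructor
  · rintro ⟨t, h0, h1, h2, h3⟩
    fin_cases k <;> simp [sideEnds] at h2 h3 <;> simp only [side] <;>
      refine ⟨?_, ?_, ?_⟩ <;> linarith
  · intro hz
    fin_cases k
    · obtain ⟨h1, h2, h3⟩ := hz
      exact ⟨z.re, by simpa, by simpa, by simp [sideEnds], by simp [sideEnds, h1]⟩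
    · obtain ⟨h1, h2, h3⟩ := hz
      exact ⟨z.im, by simpa, by simpa, by simp [sideEnds, h1], by simp [sideEnds]⟩
    · obtain ⟨h1, h2, h3⟩ := hz
      exact ⟨-z.re, by linarith, by linarith, by simp [sideEnds], by simp [sideEnds, h1]⟩
    · obtain ⟨h1, h2, h3⟩ := hz
      exact ⟨z.im, by linarith, by linarith, by simp [sideEnds]; linarith, by simp [sideEnds]⟩
    · obtain ⟨h1, h2, h3⟩ := hz
      exact ⟨-z.re, by linarith, by linarith, by simp [sideEnds], by simp [sideEnds]; linarith⟩
    · obtain ⟨h1, h2, h3⟩ := hz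
      exact ⟨-z.im, by linarith, by linarith, by simp [sideEnds]; linarith, by simp [sideEnds]⟩

theorem edgeSet_eq_range_side : edgeSet = range side := by
  refine subset_antisymm ?_ ?_
  · rintro e ⟨p, hp, q, hq, hpq, rfl⟩
    have key : ∀ k, (p, q) = sideEnds k ∨ (q, p) = sideEnds k → segment ℝ p q ∈ range side := by
      rintro k (h | h)
      · exact ⟨k, by rw [← segment_sideEnds, ← h]⟩
      · exact ⟨k, by rw [← segment_sideEnds, ← h, segment_symm]⟩
    rw [vertexSet_eq] at hp hq
    rcases hp with rfl | rfl | rfl | rfl <;> rcases hq with rfl | rfl | rfl | rfl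
    · exact absurd rfl hpq
    · exact key 0 (Or.inl rfl)
    · exact key 1 (Or.inl rfl)
    · exact key 2 (Or.inl rfl)
    · exact key 0 (Or.inr rfl)
    · exact absurd rfl hpq
    · exact key 3 (Or.inl rfl)
    · exact key 5 (Or.inl rfl)
    · exact key 1 (Or.inr rfl)
    · exact key 3 (Or.inr rfl)
    · exact absurd rfl hpq
    · exact key 4 (Or.inl rfl)
    · exact key 2 (Or.inr rfl)
    · exact key 5 (Or.inr rfl)
    · exact key 4 (Or.inr rfl)
    · exact absurd rfl hpq
  · rintro _ ⟨k, rfl⟩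
    rw [← segment_sideEnds]
    refine ⟨_, ?_, _, ?_, ?_, rfl⟩
    · rw [vertexSet_eq]
      fin_cases k <;> simp [sideEnds]
    · rw [vertexSet_eq]
      fin_cases k <;> simp [sideEnds]
    · fin_cases k <;> simp [sideEnds, Complex.ext_iff]

theorem side_inter_side {k l : Fin 6} (h : k ≠ l) : side k ∩ side l ⊆ vertexSet := by
  wlog hkl : k < l generalizing k l
  · rw [inter_comm]
    exact this h.symm (lt_of_le_of_ne (not_lt.1 hkl) h.symm)
  rintro z ⟨hk, hl⟩
  rw [mem_vertexSet]
  fin_cases k <;> fin_cases l <;> first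
    | exact absurd hkl (by decide)
    | (obtain ⟨h1, h2, h3⟩ := hk
       obtain ⟨h4, h5, h6⟩ := hl
       first
        | (exfalso; linarith)
        | exact Or.inl ⟨by linarith, by linarith⟩
        | exact Or.inr (Or.inl ⟨by linarith, by linarith⟩)
        | exact Or.inr (Or.inr (Or.inl ⟨by linarith, by linarith⟩))
        | exact Or.inr (Or.inr (Or.inr ⟨by linarith, by linarith⟩)))

theorem segment_inter_vertexSet {p q : ℂ} (hp : p ∈ vertexSet) (hq : q ∈ vertexSet) :
    segment ℝ p q ∩ vertexSet = {p, q} := by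
  refine subset_antisymm ?_ ?_
  · rintro z ⟨hz, hzV⟩
    rw [mem_segment_iff] at hz
    obtain ⟨t, h0, h1, h2, h3⟩ := hz
    simp only [mem_insert_iff, mem_singleton_iff, Complex.ext_iff]
    rw [mem_vertexSet] at hp hq hzV
    rcases hp with ⟨a1, a2⟩ | ⟨a1, a2⟩ | ⟨a1, a2⟩ | ⟨a1, a2⟩ <;>
    rcases hq with ⟨b1, b2⟩ | ⟨b1, b2⟩ | ⟨b1, b2⟩ | ⟨b1, b2⟩ <;>
    rcases hzV with ⟨c1, c2⟩ | ⟨c1, c2⟩ | ⟨c1, c2⟩ | ⟨c1, c2⟩ <;>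
    rw [a1, b1, c1] at h2 <;> rw [a2, b2, c2] at h3 <;> rw [a1, a2, b1, b2, c1, c2] <;>
    first
      | exact Or.inl ⟨rfl, rfl⟩
      | exact Or.inr ⟨rfl, rfl⟩
      | (exfalso; linarith)
  · rintro z (rfl | rfl)
    · exact ⟨left_mem_segment ℝ _ _, hp⟩
    · exact ⟨right_mem_segment ℝ _ _, hq⟩

theorem finite_vertexSet : vertexSet.Finite := (finite_range outer).insert 0

/-- The straight-line drawing of `K₄` with vertices `0`, `1`, `i` and `-1 - i`. -/
noncomputable def planeGraph : PlaneGraph where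
  verts := vertexSet
  edges := edgeSet
  verts_finite := finite_vertexSet
  edges_finite := edgeSet_eq_range_side ▸ finite_range side
  edge_isArc := by
    rintro e ⟨p, hp, q, hq, hpq, rfl⟩
    exact ⟨p, q, isArc_segment hpq, segment_inter_vertexSet hp hq⟩
  edge_inter := by
    rw [edgeSet_eq_range_side]
    rintro _ ⟨k, rfl⟩ _ ⟨l, rfl⟩ hne
    exact side_inter_side fun h => hne (congrArg side h)

theorem injective_outer : Function.Injective outer := by
  intro i j h
  rw [Complex.ext_iff] at h
  fin_cases i <;> fin_cases j <;> simp [outer] at h ⊢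

theorem outer_ne_zero (i : Fin 3) : outer i ≠ 0 := by
  fin_cases i <;> simp [outer, Complex.ext_iff]

theorem ncard_vertexSet : vertexSet.ncard = 4 := by
  rw [vertexSet, ncard_insert_of_notMem _ (finite_range outer), ← image_univ,
    ncard_image_of_injective _ injective_outer, ncard_univ, Nat.card_eq_fintype_card,
    Fintype.card_fin]
  rintro ⟨i, hi⟩
  exact outer_ne_zero i hi

theorem isSimple_planeGraph : planeGraph.IsSimple := by
  rintro _ ⟨p, hp, q, hq, -, rfl⟩ _ ⟨p', hp', q', hq', -, rfl⟩ h
  change segment ℝ p q ∩ vertexSet = segment ℝ p' q' ∩ vertexSet at h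
  rw [segment_inter_vertexSet hp hq, segment_inter_vertexSet hp' hq'] at h
  rcases pair_eq_pair_iff.1 h with ⟨rfl, rfl⟩ | ⟨rfl, rfl⟩
  · rfl
  · exact segment_symm ℝ _ _

theorem isThreeConnected_planeGraph : planeGraph.IsThreeConnected := by
  refine ⟨ncard_vertexSet.ge, fun X hX => ?_⟩
  have hV : Finite planeGraph.verts := finite_vertexSet.to_subtype
  have hne : (Xᶜ).Nonempty := by
    by_contra h
    rw [not_nonempty_iff_eq_empty, compl_empty_iff] at h
    rw [h, ncard_univ, Nat.card_coe_set_eq] at hX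
    have : vertexSet.ncard ≤ 2 := hX
    rw [ncard_vertexSet] at this
    omega
  have : Nonempty (Xᶜ : Set planeGraph.verts) := hne.to_subtype
  refine ⟨fun u v => ?_⟩
  by_cases huv : u = v
  · rw [huv]
  · refine SimpleGraph.Adj.reachable ⟨fun h => huv (Subtype.ext h), _,
      ⟨_, u.1.2, _, v.1.2, fun h => huv (Subtype.ext (Subtype.ext h)), rfl⟩, ?_⟩
    exact segment_inter_vertexSet u.1.2 v.1.2

theorem mem_support {z : ℂ} : z ∈ planeGraph.support ↔ ∃ k, z ∈ side k := by
  constructor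
  · rintro (hz | ⟨e, he, hz⟩)
    · rcases mem_vertexSet.1 hz with ⟨h1, h2⟩ | ⟨h1, h2⟩ | ⟨h1, h2⟩ | ⟨h1, h2⟩
      · exact ⟨0, by simp [side, h1, h2]⟩
      · exact ⟨0, by simp [side, h1, h2]⟩
      · exact ⟨1, by simp [side, h1, h2]⟩
      · exact ⟨2, by simp [side, h1, h2]⟩
    · have : e ∈ range side := edgeSet_eq_range_side ▸ he
      obtain ⟨k, rfl⟩ := this
      exact ⟨k, hz⟩
  · rintro ⟨k, hz⟩
    refine Or.inr ⟨side k, ?_, hz⟩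
    have : side k ∈ edgeSet := edgeSet_eq_range_side ▸ mem_range_self k
    exact this

/-- The open triangle spanned by `0` and the two outer vertices other than `outer k`. -/
def triangle : Fin 3 → Set ℂ :=
  ![{z | z.re < 0 ∧ z.re < z.im ∧ z.im < 2 * z.re + 1},
    {z | z.im < 0 ∧ z.im < z.re ∧ z.re < 2 * z.im + 1},
    {z | 0 < z.re ∧ 0 < z.im ∧ z.re + z.im < 1}]

def closedTriangle : Fin 3 → Set ℂ :=
  ![{z | z.re ≤ 0 ∧ z.re ≤ z.im ∧ z.im ≤ 2 * z.re + 1},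
    {z | z.im ≤ 0 ∧ z.im ≤ z.re ∧ z.re ≤ 2 * z.im + 1},
    {z | 0 ≤ z.re ∧ 0 ≤ z.im ∧ z.re + z.im ≤ 1}]

/-- The complement of the closed triangle spanned by the outer vertices. -/
def exterior : Set ℂ := {z | 1 < z.re + z.im} ∪ {z | 2 * z.re + 1 < z.im} ∪ {z | 2 * z.im + 1 < z.re}

theorem isOpen_triangle (k : Fin 3) : IsOpen (triangle k) := by
  have key : ∀ f : Fin 3 → ℂ → ℝ × ℝ, (∀ i, Continuous (f i)) →
      IsOpen ({z | (f 0 z).1 < (f 0 z).2} ∩ ({z | (f 1 z).1 < (f 1 z).2} ∩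
        {z | (f 2 z).1 < (f 2 z).2})) := fun f hf =>
    (isOpen_lt (hf 0).fst (hf 0).snd).inter
      ((isOpen_lt (hf 1).fst (hf 1).snd).inter (isOpen_lt (hf 2).fst (hf 2).snd))
  fin_cases k
  · exact key ![fun z => (z.re, 0), fun z => (z.re, z.im), fun z => (z.im, 2 * z.re + 1)]
      fun i => by fin_cases i <;> simp <;> constructor <;> fun_prop
  · exact key ![fun z => (z.im, 0), fun z => (z.im, z.re), fun z => (z.re, 2 * z.im + 1)]
      fun i => by fin_cases i <;> simp <;> constructor <;> fun_prop
  · exact key ![fun z => (0, z.re), fun z => (0, z.im), fun z => (z.re + z.im, 1)]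
      fun i => by fin_cases i <;> simp <;> constructor <;> fun_prop

theorem isOpen_exterior : IsOpen exterior :=
  ((isOpen_lt (by fun_prop) (by fun_prop)).union (isOpen_lt (by fun_prop) (by fun_prop))).union
    (isOpen_lt (by fun_prop) (by fun_prop))

theorem isClosed_closedTriangle (k : Fin 3) : IsClosed (closedTriangle k) := by
  have key : ∀ f : Fin 3 → ℂ → ℝ × ℝ, (∀ i, Continuous (f i)) →
      IsClosed ({z | (f 0 z).1 ≤ (f 0 z).2} ∩ ({z | (f 1 z).1 ≤ (f 1 z).2} ∩
        {z | (f 2 z).1 ≤ (f 2 z).2})) := fun f hf =>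
    (isClosed_le (hf 0).fst (hf 0).snd).inter
      ((isClosed_le (hf 1).fst (hf 1).snd).inter (isClosed_le (hf 2).fst (hf 2).snd))
  fin_cases k
  · exact key ![fun z => (z.re, 0), fun z => (z.re, z.im), fun z => (z.im, 2 * z.re + 1)]
      fun i => by fin_cases i <;> simp <;> constructor <;> fun_prop
  · exact key ![fun z => (z.im, 0), fun z => (z.im, z.re), fun z => (z.re, 2 * z.im + 1)]
      fun i => by fin_cases i <;> simp <;> constructor <;> fun_prop
  · exact key ![fun z => (0, z.re), fun z => (0, z.im), fun z => (z.re + z.im, 1)]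
      fun i => by fin_cases i <;> simp <;> constructor <;> fun_prop

theorem closure_triangle_subset (k : Fin 3) : closure (triangle k) ⊆ closedTriangle k := by
  refine closure_minimal (fun z hz => ?_) (isClosed_closedTriangle k)
  fin_cases k <;> exact ⟨hz.1.le, hz.2.1.le, hz.2.2.le⟩

theorem convex_triangle (k : Fin 3) : Convex ℝ (triangle k) := by
  intro x hx y hy a b ha hb hab
  have hb' : b = 1 - a := by linarith
  subst hb'
  have key : ∀ s t : ℝ, 0 < s → 0 < t → 0 < a * s + (1 - a) * t := by
    intro s t hs ht
    rcases ha.eq_or_lt with rfl | ha'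
    · simpa using ht
    · exact add_pos_of_pos_of_nonneg (mul_pos ha' hs) (mul_nonneg hb ht.le)
  fin_cases k
  all_goals
    have h1 := key _ _ (sub_pos.2 hx.1) (sub_pos.2 hy.1)
    have h2 := key _ _ (sub_pos.2 hx.2.1) (sub_pos.2 hy.2.1)
    have h3 := key _ _ (sub_pos.2 hx.2.2) (sub_pos.2 hy.2.2)
    refine ⟨?_, ?_, ?_⟩ <;>
      simp only [Complex.add_re, Complex.add_im, Complex.real_smul, Complex.re_ofReal_mul,
        Complex.im_ofReal_mul] <;>
      linarith

theorem disjoint_triangle {k l : Fin 3} (h : k ≠ l) : Disjoint (triangle k) (triangle l) := by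
  rw [disjoint_left]
  intro z hz hz'
  fin_cases k <;> fin_cases l <;> first
    | exact h rfl
    | (obtain ⟨h1, h2, h3⟩ := hz
       obtain ⟨h4, h5, h6⟩ := hz'
       linarith)

theorem disjoint_triangle_exterior (k : Fin 3) : Disjoint (triangle k) exterior := by
  rw [disjoint_left]
  rintro z hz ((h' | h') | h') <;>
  · have h'' := mem_ofPred_eq ▸ h'
    fin_cases k <;> obtain ⟨h1, h2, h3⟩ := hz <;> linarith

theorem triangle_subset_compl_support (k : Fin 3) : triangle k ⊆ planeGraph.supportᶜ := by
  intro z hz h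
  obtain ⟨l, hl⟩ := mem_support.1 h
  fin_cases k <;> obtain ⟨h1, h2, h3⟩ := hz <;> fin_cases l <;> obtain ⟨h4, h5, h6⟩ := hl <;>
    linarith

theorem compl_support_subset {z : ℂ} (hz : z ∉ planeGraph.support) :
    z ∈ exterior ∨ ∃ k, z ∈ triangle k := by
  by_contra! h
  obtain ⟨he, ht⟩ := h
  have he' : ¬ (1 < z.re + z.im) ∧ ¬ (2 * z.re + 1 < z.im) ∧ ¬ (2 * z.im + 1 < z.re) :=
    ⟨fun h => he (Or.inl (Or.inl h)), fun h => he (Or.inl (Or.inr h)), fun h => he (Or.inr h)⟩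
  have t0 : ¬ (z.re < 0 ∧ z.re < z.im ∧ z.im < 2 * z.re + 1) := ht 0
  have t1 : ¬ (z.im < 0 ∧ z.im < z.re ∧ z.re < 2 * z.im + 1) := ht 1
  have t2 : ¬ (0 < z.re ∧ 0 < z.im ∧ z.re + z.im < 1) := ht 2
  have s0 : ¬ (z.im = 0 ∧ 0 ≤ z.re ∧ z.re ≤ 1) := fun h => hz (mem_support.2 ⟨0, h⟩)
  have s1 : ¬ (z.re = 0 ∧ 0 ≤ z.im ∧ z.im ≤ 1) := fun h => hz (mem_support.2 ⟨1, h⟩)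
  have s2 : ¬ (z.re = z.im ∧ -1 ≤ z.re ∧ z.re ≤ 0) := fun h => hz (mem_support.2 ⟨2, h⟩)
  have s3 : ¬ (z.re + z.im = 1 ∧ 0 ≤ z.im ∧ z.im ≤ 1) := fun h => hz (mem_support.2 ⟨3, h⟩)
  have s4 : ¬ (z.im = 2 * z.re + 1 ∧ -1 ≤ z.re ∧ z.re ≤ 0) := fun h => hz (mem_support.2 ⟨4, h⟩)
  have s5 : ¬ (z.re = 2 * z.im + 1 ∧ -1 ≤ z.im ∧ z.im ≤ 0) := fun h => hz (mem_support.2 ⟨5, h⟩)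
  simp only [not_lt] at he'
  obtain ⟨e0, e1, e2⟩ := he'
  have e0' := lt_of_le_of_ne e0 fun h => s3 ⟨h, by linarith, by linarith⟩
  have e1' := lt_of_le_of_ne e1 fun h => s4 ⟨h, by linarith, by linarith⟩
  have e2' := lt_of_le_of_ne e2 fun h => s5 ⟨h, by linarith, by linarith⟩
  rcases lt_trichotomy z.re 0 with hx | hx | hx <;> rcases lt_trichotomy z.im 0 with hy | hy | hy
  · rcases lt_trichotomy z.re z.im with h | h | h
    · exact t0 ⟨hx, h, e1'⟩
    · exact s2 ⟨h, by linarith, hx.le⟩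
    · exact t1 ⟨hy, h, e2'⟩
  · exact t0 ⟨hx, by linarith, e1'⟩
  · exact t0 ⟨hx, by linarith, e1'⟩
  · exact t1 ⟨hy, by linarith, e2'⟩
  · exact s0 ⟨hy, by linarith, by linarith⟩
  · exact s1 ⟨hx, hy.le, by linarith⟩
  · exact t1 ⟨hy, by linarith, e2'⟩
  · exact s0 ⟨hy, hx.le, by linarith⟩
  · exact t2 ⟨hx, hy, e0'⟩

theorem connectedComponentIn_triangle {k : Fin 3} {z : ℂ} (hz : z ∈ triangle k) :
    connectedComponentIn planeGraph.supportᶜ z = triangle k := by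
  refine subset_antisymm ?_ ((convex_triangle k).isPreconnected.subset_connectedComponentIn hz
    (triangle_subset_compl_support k))
  refine isPreconnected_connectedComponentIn.subset_left_of_subset_union (isOpen_triangle k)
    (v := exterior ∪ ⋃ l ∈ ({k}ᶜ : Set (Fin 3)), triangle l)
    (isOpen_exterior.union (isOpen_biUnion fun l _ => isOpen_triangle l)) ?_ ?_
    ⟨z, mem_connectedComponentIn (triangle_subset_compl_support k hz), hz⟩
  · refine (disjoint_triangle_exterior k).union_right ?_
    exact disjoint_iUnion₂_right.2 fun l hl => disjoint_triangle fun h => hl h.symm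
  · intro w hw
    rcases compl_support_subset (connectedComponentIn_subset _ _ hw) with h | ⟨l, hl⟩
    · exact Or.inr (Or.inl h)
    · by_cases hlk : l = k
      · exact Or.inl (hlk ▸ hl)
      · exact Or.inr (Or.inr (mem_biUnion hlk hl))

theorem eq_triangle_or_subset_exterior {f : Set ℂ} (hf : f ∈ planeGraph.faces) :
    (∃ k, f = triangle k) ∨ f ⊆ exterior := by
  obtain ⟨z, hz, rfl⟩ := hf
  by_cases h : ∃ w ∈ connectedComponentIn planeGraph.supportᶜ z, ∃ k, w ∈ triangle k
  · obtain ⟨w, hw, k, hk⟩ := h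
    exact Or.inl ⟨k, by rw [connectedComponentIn_eq hw, connectedComponentIn_triangle hk]⟩
  · push Not at h
    refine Or.inr fun w hw => ?_
    rcases compl_support_subset (connectedComponentIn_subset _ _ hw) with h' | ⟨l, hl⟩
    · exact h'
    · exact absurd hl (h w hw l)

/-- An inner point of each triangle. -/
noncomputable def center : Fin 3 → ℂ :=
  ![⟨-1 / 3, 0⟩, ⟨0, -1 / 3⟩, ⟨1 / 3, 1 / 3⟩]

theorem spoke_mem_closure {i k : Fin 3} (h : i ≠ k) {t : ℝ} (h0 : 0 ≤ t) (h1 : t ≤ 1) :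
    (t : ℂ) * outer i ∈ closure (triangle k) := by
  let φ : ℝ → ℂ := fun s => ((1 - s : ℝ) : ℂ) * ((t : ℂ) * outer i) + (s : ℂ) * center k
  have hφ : Continuous φ := by fun_prop
  have h00 : (0 : ℝ) ∈ closure (Ioc (0 : ℝ) 1) := by
    rw [closure_Ioc zero_ne_one]
    exact ⟨le_rfl, zero_le_one⟩
  have := hφ.continuousWithinAt.mem_closure (t := triangle k) h00 (fun s hs => ?_)
  · simpa [φ] using this
  · obtain ⟨hs0, hs1⟩ := hs
    have hst : 0 ≤ (1 - s) * t := mul_nonneg (by linarith) h0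
    have hst' : 0 ≤ (1 - s) * (1 - t) := mul_nonneg (by linarith) (by linarith)
    have hre : (φ s).re = (1 - s) * t * (outer i).re + s * (center k).re := by
      simp only [φ, Complex.add_re, Complex.re_ofReal_mul]
      ring
    have him : (φ s).im = (1 - s) * t * (outer i).im + s * (center k).im := by
      simp only [φ, Complex.add_im, Complex.im_ofReal_mul]
      ring
    fin_cases i <;> fin_cases k <;> first
      | exact absurd rfl h
      | (simp [outer, center] at hre him
         refine ⟨?_, ?_, ?_⟩ <;> linarith)

theorem spoke_notMem_closure (i : Fin 3) {t : ℝ} (h0 : 0 < t) :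
    (t : ℂ) * outer i ∉ closure (triangle i) := by
  intro h
  have := closure_triangle_subset i h
  fin_cases i <;> obtain ⟨h1, h2, h3⟩ := this <;> simp [outer] at h1 h2 h3 <;> linarith

theorem spoke_notMem_closure_exterior (i : Fin 3) {t : ℝ} (h0 : 0 < t) (h1 : t < 1) :
    (t : ℂ) * outer i ∉ closure exterior := by
  intro h
  have hsub : closure exterior ⊆ {z | 1 ≤ z.re + z.im} ∪ {z | 2 * z.re + 1 ≤ z.im} ∪
      {z | 2 * z.im + 1 ≤ z.re} := by
    refine closure_minimal ?_ (((isClosed_le (by fun_prop) (by fun_prop)).union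
      (isClosed_le (by fun_prop) (by fun_prop))).union (isClosed_le (by fun_prop) (by fun_prop)))
    rintro z ((hz | hz) | hz)
    · exact Or.inl (Or.inl (le_of_lt hz.out))
    · exact Or.inl (Or.inr (le_of_lt hz.out))
    · exact Or.inr (le_of_lt hz.out)
  rcases hsub h with (h' | h') | h' <;> fin_cases i <;> simp [outer] at h' <;> linarith

end Tetrahedron

namespace Tetrahedron

theorem center_mem_triangle (k : Fin 3) : center k ∈ triangle k := by
  fin_cases k <;> refine ⟨?_, ?_, ?_⟩ <;> norm_num [center]

theorem triangle_mem_faces (k : Fin 3) : triangle k ∈ planeGraph.faces :=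
  ⟨center k, triangle_subset_compl_support k (center_mem_triangle k),
    (connectedComponentIn_triangle (center_mem_triangle k)).symm⟩

theorem spoke_mem_support (i : Fin 3) {t : ℝ} (h0 : 0 ≤ t) (h1 : t ≤ 1) :
    (t : ℂ) * outer i ∈ planeGraph.support := by
  refine Or.inr ⟨segment ℝ 0 (outer i), ⟨0, mem_insert _ _, outer i, mem_insert_of_mem _ ⟨i, rfl⟩,
    (outer_ne_zero i).symm, rfl⟩, ?_⟩
  exact mem_segment_iff.2 ⟨t, h0, h1, by simp, by simp⟩

theorem spoke_mem_frontier {i k : Fin 3} (h : i ≠ k) {t : ℝ} (h0 : 0 ≤ t) (h1 : t ≤ 1) :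
    (t : ℂ) * outer i ∈ frontier (triangle k) :=
  (PlaneGraph.mem_frontier_of_mem_support (triangle_mem_faces k) (spoke_mem_support i h0 h1)).2
    (spoke_mem_closure h h0 h1)

/-- The points on the spokes whose relative distance from the center lies in `P`. -/
noncomputable def spokePoints (A : Set (Fin 3)) (P : Set ℝ) : Set ℂ :=
  (fun x : Fin 3 × ℝ => (x.2 : ℂ) * outer x.1) '' (A ×ˢ P)

theorem spoke_inj {i j : Fin 3} {s t : ℝ} (hs : 0 < s) (ht : 0 < t)
    (h : (s : ℂ) * outer i = t * outer j) : i = j ∧ s = t := by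
  rw [Complex.ext_iff] at h
  obtain ⟨h1, h2⟩ := h
  fin_cases i <;> fin_cases j <;> simp [outer] at h1 h2 ⊢ <;> linarith

theorem ncard_spokePoints (A : Set (Fin 3)) {P : Set ℝ} (hP : P ⊆ Ioi 0) :
    (spokePoints A P).ncard = A.ncard * P.ncard := by
  rw [spokePoints, InjOn.ncard_image, ncard_prod]
  rintro ⟨i, s⟩ ⟨-, hs⟩ ⟨j, t⟩ ⟨-, ht⟩ h
  obtain ⟨rfl, rfl⟩ := spoke_inj (hP hs) (hP ht) h
  rfl

theorem vertexSet_subset_spokes {z : ℂ} (hz : z ∈ vertexSet) :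
    ∃ i, ∃ t : ℝ, 0 ≤ t ∧ t ≤ 1 ∧ z = t * outer i := by
  rcases hz with rfl | ⟨i, rfl⟩
  · exact ⟨0, 0, le_rfl, zero_le_one, by simp⟩
  · exact ⟨i, 1, zero_le_one, le_rfl, by simp⟩

theorem disjoint_vertexSet_spokePoints {A : Set (Fin 3)} {P : Set ℝ} (hP : P ⊆ Ioo 0 1) :
    Disjoint vertexSet (spokePoints A P) := by
  rw [disjoint_left]
  rintro _ hz ⟨⟨i, t⟩, ⟨-, ht⟩, rfl⟩
  rcases hz with hz | ⟨j, hz⟩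
  · rcases mul_eq_zero.1 hz with h | h
    · exact (hP ht).1.ne' (by exact_mod_cast h)
    · exact outer_ne_zero i h
  · have := (spoke_inj (i := j) (j := i) one_pos (hP ht).1 (by simpa using hz)).2
    exact (hP ht).2.ne this.symm

theorem spokePoints_inter_frontier_triangle {P : Set ℝ} (hP : P ⊆ Ioo 0 1) (k : Fin 3) :
    spokePoints univ P ∩ frontier (triangle k) = spokePoints {k}ᶜ P := by
  refine subset_antisymm ?_ ?_
  · rintro _ ⟨⟨⟨i, t⟩, ⟨-, ht⟩, rfl⟩, hz⟩
    refine ⟨(i, t), ⟨?_, ht⟩, rfl⟩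
    rintro rfl
    exact spoke_notMem_closure i (hP ht).1 hz.1
  · rintro _ ⟨⟨i, t⟩, ⟨hi, ht⟩, rfl⟩
    exact ⟨⟨(i, t), ⟨trivial, ht⟩, rfl⟩, spoke_mem_frontier hi (hP ht).1.le (hP ht).2.le⟩

theorem spokePoints_inter_frontier_of_subset_exterior {P : Set ℝ} (hP : P ⊆ Ioo 0 1) {f : Set ℂ}
    (hf : f ⊆ exterior) : spokePoints univ P ∩ frontier f = ∅ := by
  refine eq_empty_of_forall_notMem ?_
  rintro _ ⟨⟨⟨i, t⟩, ⟨-, ht⟩, rfl⟩, hz⟩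
  exact spoke_notMem_closure_exterior i (hP ht).1 (hP ht).2 (closure_mono hf hz.1)

theorem exists_common_face {G : PlaneGraph} (hG : G.faces = planeGraph.faces)
    (hV : ∀ z ∈ G.verts, ∃ i, ∃ t : ℝ, 0 ≤ t ∧ t ≤ 1 ∧ z = t * outer i) :
    ∀ u ∈ G.verts, ∀ v ∈ G.verts, ∃ f ∈ G.faces, u ∈ frontier f ∧ v ∈ frontier f := by
  intro u hu v hv
  obtain ⟨i, s, hs0, hs1, rfl⟩ := hV u hu
  obtain ⟨j, t, ht0, ht1, rfl⟩ := hV v hv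
  have hthird : ∀ i j : Fin 3, ∃ k, i ≠ k ∧ j ≠ k := by decide
  obtain ⟨k, hik, hjk⟩ := hthird i j
  exact ⟨triangle k, hG ▸ triangle_mem_faces k, spoke_mem_frontier hik hs0 hs1,
    spoke_mem_frontier hjk ht0 ht1⟩

/-- Subdividing each of the three edges at the inner vertex of `K₄` with `a` new vertices. -/
theorem exists_subdivision (a : ℕ) : ∃ G : PlaneGraph, G.IsSubdivision planeGraph ∧
    IsGreatest (G.degreeDifferences planeGraph) (2 * (a : ℤ)) ∧
    G.cyclicChromaticNumber = 3 * a + planeGraph.cyclicChromaticNumber := by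
  obtain ⟨P, hP, hPfin, hPa⟩ :=
    (Ioo_infinite (zero_lt_one (α := ℝ))).exists_subset_ncard_eq a
  have hfin : (spokePoints univ P).Finite := (finite_univ.prod hPfin).image _
  obtain ⟨G, hG, hV⟩ := planeGraph.exists_isSubdivision hfin (by
    rintro _ ⟨⟨i, t⟩, ⟨-, ht⟩, rfl⟩
    exact spoke_mem_support i (hP ht).1.le (hP ht).2.le)
  change G.verts = vertexSet ∪ spokePoints univ P at hV
  have hdisj := disjoint_vertexSet_spokePoints (A := univ) hP
  have hnew : G.verts \ planeGraph.verts = spokePoints univ P := by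
    rw [hV]
    exact hdisj.sup_sdiff_cancel_left
  have hpos : P ⊆ Ioi 0 := fun t ht => (hP ht).1
  have hdeg : ∀ k, (G.faceDegree (triangle k) : ℤ) - planeGraph.faceDegree (triangle k) = 2 * a := by
    intro k
    rw [PlaneGraph.faceDegree_sub_of_verts_subset hG.verts_subset, hnew,
      spokePoints_inter_frontier_triangle hP, ncard_spokePoints _ hpos, hPa, ncard_compl,
      ncard_singleton, Nat.card_eq_fintype_card, Fintype.card_fin]
    norm_num
  refine ⟨G, hG, ⟨⟨triangle 0, hG.faces_eq ▸ triangle_mem_faces 0, (hdeg 0).symm⟩, ?_⟩, ?_⟩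
  · rintro _ ⟨f, hf, rfl⟩
    rcases eq_triangle_or_subset_exterior (hG.faces_eq ▸ hf) with ⟨k, rfl⟩ | hext
    · exact (hdeg k).le
    · rw [PlaneGraph.faceDegree_sub_of_verts_subset hG.verts_subset, hnew,
        spokePoints_inter_frontier_of_subset_exterior hP hext, ncard_empty]
      positivity
  · rw [PlaneGraph.cyclicChromaticNumber_eq_ncard (exists_common_face hG.faces_eq ?_),
      PlaneGraph.cyclicChromaticNumber_eq_ncard (exists_common_face rfl fun z hz =>
        vertexSet_subset_spokes hz), hV, ncard_union_eq hdisj finite_vertexSet hfin,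
      ncard_spokePoints _ hpos, hPa, ncard_univ, Nat.card_eq_fintype_card, Fintype.card_fin]
    · exact add_comm _ _
    · rw [hV]
      rintro z (hz | ⟨⟨i, t⟩, ⟨-, ht⟩, rfl⟩)
      · exact vertexSet_subset_spokes hz
      · exact ⟨i, t, (hP ht).1.le, (hP ht).2.le, rfl⟩

end Tetrahedron

theorem theorem7 :
    (∀ R G : PlaneGraph, R.IsThreeConnected → G.IsSubdivision R →
      ∃ M : ℤ, IsGreatest (G.degreeDifferences R) M ∧
        (G.cyclicChromaticNumber : ℤ) ≤ ⌊(3 / 2 : ℝ) * (M : ℝ)⌋ + (R.cyclicChromaticNumber : ℤ)) ∧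
    (∀ a : ℕ, 2 ≤ a →
      ∃ R G : PlaneGraph, R.IsThreeConnected ∧ R.IsSimple ∧ G.IsSubdivision R ∧
        ∃ M : ℤ, M = 2 * (a : ℤ) ∧ IsGreatest (G.degreeDifferences R) M ∧
          (G.cyclicChromaticNumber : ℤ) =
            ⌊(3 / 2 : ℝ) * (M : ℝ)⌋ + (R.cyclicChromaticNumber : ℤ)) := by
  constructor
  · intro R G _ hG
    obtain ⟨M, hM⟩ := hG.exists_isGreatest
    refine ⟨M, hM, ?_⟩
    rw [PlaneGraph.floor_three_halves]
    exact_mod_cast hG.cyclicChromaticNumber_le hM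
  · intro a _
    obtain ⟨G, hG, hM, hχ⟩ := Tetrahedron.exists_subdivision a
    refine ⟨Tetrahedron.planeGraph, G, Tetrahedron.isThreeConnected_planeGraph,
      Tetrahedron.isSimple_planeGraph, hG, 2 * (a : ℤ), rfl, hM, ?_⟩
    have h := PlaneGraph.floor_three_halves (2 * a)
    have h3 : 3 * (2 * a) / 2 = 3 * a := by omega
    rw [h3] at h
    push_cast at h ⊢
    rw [h, hχ]
    push_cast
    ring
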